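/- Let $p$ be a prime, $n\ge 0$, $R=\mathbb{F}_p[x,x^{-1}]=\mathbb{F}_p[\mathbb{Z}]$, and let $\mathcal{L}_n=(\mathbb{Z}/p\mathbb{Z})^n\wr\mathbb{Z}=\mathcal{A}_n\rtimes\mathbb{Z}$, where $\mathcal{A}_n=\bigoplus_{\mathbb{Z}}(\mathbb{Z}/p\mathbb{Z})^n$ is identified with $R^n$ and the product is $(v,s)(w,t)=(v+x^sw,s+t)$. A triple of a subgroup $V\le\mathcal{L}_n$ is $(s,V_0,v)$ where $s\in\mathbb{Z}_{\ge 0}$, the projection of $V$ to $\mathbb{Z}$ is $s\mathbb{Z}$, $V_0=V\cap\mathcal{A}_n$, and $v\in\mathcal{A}_n$ satisfies $(v,s)\in V$. For $s>0$ let $|s|_p$ be the largest integer $e\geq 0$ such that $p^e$ divides $s$. A subgroup $H$ of a group $G$ is closed in the pro-$p$ topology if $\pi_p(H)$ is the intersection of $\pi_p(G)$ with the closure of $\pi_p(H)$ in $\widehat{G}^{(p)}=\varprojlim G/N$, where $N$ runs over the normal subgroups of $G$ whose index is a power of $p$ and $\pi_p:G\to\widehat{G}^{(p)}$ is the natural map.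 Let $\mathbb{F}_p[[\mathbb{Z}_p]]=\varprojlim_m\mathbb{F}_p[\mathbb{Z}/p^m\mathbb{Z}]$ with the inverse limit topology. For a subgroup $U\le\mathcal{A}_n$ let $e(U)$ be the least integer $e>0$ with $x^eU=U$, and $e(U)=+\infty$ if there is none ($+\infty$ divides no integer). If $e=e(U)$ is finite, regard $\mathcal{A}_n$ as an $R$-module via $x*v=x^ev$; it is free of rank $ne$ and $U$ is a submodule, so that $\mathcal{A}_n/U\cong\bigoplus_{i=1}^{N}R/q_i^{r_i}R$ for some finite $N$, where each $q_i\in\mathbb{F}_p[x]$ is either $0$ or irreducible with $q_i(0)=1$; put ${\det}^*U=\prod_{i:\,q_i\ne0}q_i^{r_i}\in\mathbb{F}_p[x]$. **Theorem.** Let $V$ be a subgroup of $\mathcal{L}_n$ with a triple $(s,V_0,v)$. Then $V$ is closed in the pro-$p$ topology of $\mathcal{L}_n$ if and only if one of the following holds: 1. $s=0$, and $V_0$ is equal to the intersection of its closure in $\mathbb{F}_p[[\mathbb{Z}_p]]^n$ with $\mathcal{A}_n$; 2. $s>0$, $e(V_0)$ divides $p^{|s|_p}$, ${\det}^*V_0=(1-x)^k$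 for some integer $k\ge0$, and for every integer $q$ with $0<q<s$ and $|q|_p\ge|s|_p$ $$(x^q-1)v\notin(x^s-1)\mathcal{A}_n+(x-1)^{p^{|s|_p}}V_0 .$$ -/

import Mathlib

open LaurentPolynomial

noncomputable section

/-! ### The base group and the lamplighter group -/

/-- The base group `𝓐_n = ⨁_ℤ (ℤ/p)^n`, identified with `R^n` for `R = 𝔽_p[x, x⁻¹] = 𝔽_p[ℤ]`;
the variable `x` of `R` is `T 1`, and the shift of `𝓐_n` is multiplication by `x`. -/
abbrev LampBase (p n : ℕ) : Type := Fin n → (ZMod p)[T;T⁻¹]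

/-- The `k`-th power of the shift: the automorphism `v ↦ x^k v` of `𝓐_n`. -/
def lampShift (p n : ℕ) (k : ℤ) : LampBase p n ≃+ LampBase p n where
  toFun v := (T k : (ZMod p)[T;T⁻¹]) • v
  invFun v := (T (-k) : (ZMod p)[T;T⁻¹]) • v
  left_inv v := by
    change (T (-k) : (ZMod p)[T;T⁻¹]) • ((T k : (ZMod p)[T;T⁻¹]) • v) = v
    rw [smul_smul, ← T_add, neg_add_cancel, T_zero, one_smul]
  right_inv v := by
    change (T k : (ZMod p)[T;T⁻¹]) • ((T (-k) : (ZMod p)[T;T⁻¹]) • v) = v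
    rw [smul_smul, ← T_add, add_neg_cancel, T_zero, one_smul]
  map_add' v w := smul_add _ v w

/-- The action of `ℤ` on `𝓐_n` by shifts. -/
def lampAction (p n : ℕ) : Multiplicative ℤ →* MulAut (Multiplicative (LampBase p n)) where
  toFun k := AddEquiv.toMultiplicative (lampShift p n k.toAdd)
  map_one' := by
    ext v : 1
    change Multiplicative.ofAdd ((T 0 : (ZMod p)[T;T⁻¹]) • v.toAdd) = v
    rw [T_zero, one_smul, ofAdd_toAdd]
  map_mul' j k := by
    ext v : 1
    change Multiplicative.ofAdd ((T (j.toAdd + k.toAdd) : (ZMod p)[T;T⁻¹]) • v.toAdd) =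
      Multiplicative.ofAdd ((T j.toAdd : (ZMod p)[T;T⁻¹]) •
        ((T k.toAdd : (ZMod p)[T;T⁻¹]) • v.toAdd))
    rw [smul_smul, ← T_add]

/-- The group `𝓛_n = (ℤ/p)^n ≀ ℤ = 𝓐_n ⋊ ℤ`. -/
abbrev Lamplighter (p n : ℕ) : Type :=
  SemidirectProduct (Multiplicative (LampBase p n)) (Multiplicative ℤ) (lampAction p n)

/-- The element `(v, s)` of `𝓛_n`. -/
def lampElt {p n : ℕ} (v : LampBase p n) (s : ℤ) : Lamplighter p n :=
  ⟨Multiplicative.ofAdd v, Multiplicative.ofAdd s⟩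

theorem lampElt_mul {p n : ℕ} (v w : LampBase p n) (s t : ℤ) :
    lampElt v s * lampElt w t = lampElt (v + (T s : (ZMod p)[T;T⁻¹]) • w) (s + t) := rfl

/-- `(s, V₀, v)` is a triple of the subgroup `V` of `𝓛_n`: the projection of `V` to `ℤ` is `sℤ`,
`V₀ = V ∩ 𝓐_n`, and `(v, s) ∈ V`. -/
structure IsLampTriple {p n : ℕ} (V : Subgroup (Lamplighter p n)) (s : ℕ)
    (V₀ : AddSubgroup (LampBase p n)) (v : LampBase p n) : Prop where
  map_right : V.map SemidirectProduct.rightHom =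
    Subgroup.zpowers (Multiplicative.ofAdd (s : ℤ))
  mem_base : ∀ w : LampBase p n, w ∈ V₀ ↔ lampElt w 0 ∈ V
  elt_mem : lampElt v s ∈ V

/-! ### The pro-`p` completion of a group and closed subgroups -/

/-- The normal subgroups of `G` whose index is a power of `p`. -/
def PPowerNormal (p : ℕ) (G : Type*) [Group G] : Type _ :=
  {N : Subgroup G // N.Normal ∧ ∃ k : ℕ, N.index = p ^ k}

/-- The underlying set of the pro-`p` completion of `G`: the inverse limit of the sets `G ⧸ N`,
where `N` runs over the normal subgroups of `p`-power index. -/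
def ProPCompletion (p : ℕ) (G : Type*) [Group G] : Type _ :=
  {f : ∀ N : PPowerNormal p G, G ⧸ N.1 //
    ∀ (N M : PPowerNormal p G) (h : N.1 ≤ M.1), Subgroup.quotientMapOfLE h (f N) = f M}

/-- The topology of the inverse limit, each `G ⧸ N` being discrete. -/
instance ProPCompletion.instTopologicalSpace (p : ℕ) (G : Type*) [Group G] :
    TopologicalSpace (ProPCompletion p G) :=
  TopologicalSpace.induced Subtype.val (@Pi.topologicalSpace _ _ (fun _ => ⊥))

/-- The natural map `π_p` from `G` to its pro-`p` completion. -/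
def ProPCompletion.of (p : ℕ) (G : Type*) [Group G] (g : G) : ProPCompletion p G :=
  ⟨fun N => (g : G ⧸ N.1), fun _ _ _ => rfl⟩

/-- `H` is closed in the pro-`p` topology of `G`: `π_p(H)` is the intersection of its closure in
the pro-`p` completion with `π_p(G)`. -/
def IsProPClosed (p : ℕ) {G : Type*} [Group G] (H : Subgroup G) : Prop :=
  ProPCompletion.of p G '' H =
    closure (ProPCompletion.of p G '' H) ∩ Set.range (ProPCompletion.of p G)

/-! ### The completed group algebra `𝔽_p[[ℤ_p]]` -/

/-- The transition map `𝔽_p[ℤ/p^k] → 𝔽_p[ℤ/p^m]` for `m ≤ k`. -/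
def cyclicAlgebraMap (p : ℕ) {m k : ℕ} (h : m ≤ k) :
    AddMonoidAlgebra (ZMod p) (ZMod (p ^ k)) →+* AddMonoidAlgebra (ZMod p) (ZMod (p ^ m)) :=
  AddMonoidAlgebra.mapDomainRingHom (ZMod p)
    (ZMod.castHom (pow_dvd_pow p h) (ZMod (p ^ m))).toAddMonoidHom

/-- The ring `𝔽_p[[ℤ_p]]`, the inverse limit of the group rings `𝔽_p[ℤ/p^m]`. -/
def CompletedGroupAlgebra (p : ℕ) :
    Subring (∀ m : ℕ, AddMonoidAlgebra (ZMod p) (ZMod (p ^ m))) where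
  carrier := {f | ∀ (m k : ℕ) (h : m ≤ k), cyclicAlgebraMap p h (f k) = f m}
  mul_mem' hf hg m k h := by simp [hf m k h, hg m k h]
  one_mem' m k h := by simp
  add_mem' hf hg m k h := by simp [hf m k h, hg m k h]
  zero_mem' m k h := by simp
  neg_mem' hf m k h := by simp [hf m k h]

/-- The topology of the inverse limit, each `𝔽_p[ℤ/p^m]` being discrete. -/
instance CompletedGroupAlgebra.instTopologicalSpace (p : ℕ) :
    TopologicalSpace (CompletedGroupAlgebra p) :=
  TopologicalSpace.induced Subtype.val (@Pi.topologicalSpace _ _ (fun _ => ⊥))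

/-- The natural ring homomorphism `R = 𝔽_p[ℤ] → 𝔽_p[[ℤ_p]]`. -/
def CompletedGroupAlgebra.of (p : ℕ) : (ZMod p)[T;T⁻¹] →+* CompletedGroupAlgebra p :=
  RingHom.codRestrict
    (RingHom.pi fun m => AddMonoidAlgebra.mapDomainRingHom (ZMod p) (Int.castAddHom (ZMod (p ^ m))))
    (CompletedGroupAlgebra p) (fun f m k h => by
      change cyclicAlgebraMap p h (AddMonoidAlgebra.mapDomain (Int.castAddHom (ZMod (p ^ k))) f) =
        AddMonoidAlgebra.mapDomain (Int.castAddHom (ZMod (p ^ m))) f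
      apply AddMonoidAlgebra.coeff_injective
      simp only [AddMonoidAlgebra.mapDomain, cyclicAlgebraMap,
        AddMonoidAlgebra.mapDomainRingHom_apply, ← Finsupp.mapDomain_comp]
      congr 1
      funext a
      exact map_intCast (ZMod.castHom (pow_dvd_pow p h) (ZMod (p ^ m))) a)

/-- The natural map `𝓐_n = R^n → 𝔽_p[[ℤ_p]]^n`. -/
def lampBaseToCompleted (p n : ℕ) (v : LampBase p n) : Fin n → CompletedGroupAlgebra p :=
  fun i => CompletedGroupAlgebra.of p (v i)

/-- `U ≤ 𝓐_n` is closed with respect to `𝔽_p[[ℤ_p]]^n`: `U` is the intersection of its closure in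
`𝔽_p[[ℤ_p]]^n` (with the product topology) with `𝓐_n`. -/
def IsClosedInCompleted {p n : ℕ} (U : AddSubgroup (LampBase p n)) : Prop :=
  lampBaseToCompleted p n '' U =
    closure (lampBaseToCompleted p n '' U) ∩ Set.range (lampBaseToCompleted p n)

/-! ### The invariants `e(U)` and `det* U` -/

/-- `e(U)`: the least `e > 0` with `x^e U = U`. If there is none (that is, `e(U) = +∞`), the value
is `0`, which divides no positive integer. -/
def lampPeriod {p n : ℕ} (U : AddSubgroup (LampBase p n)) : ℕ :=
  sInf {e : ℕ | 0 < e ∧ U.map (lampShift p n e).toAddMonoidHom = U}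

/-- The endomorphism `f(x) ↦ f(x^e)` of `R`. -/
def laurentExpand (p e : ℕ) : (ZMod p)[T;T⁻¹] →+* (ZMod p)[T;T⁻¹] :=
  AddMonoidAlgebra.mapDomainRingHom (ZMod p) (nsmulAddMonoidHom e : ℤ →+ ℤ)

theorem laurentExpand_T (p e : ℕ) (k : ℤ) :
    laurentExpand p e (T k : (ZMod p)[T;T⁻¹]) = T (e * k) := by
  simp only [laurentExpand, T, AddMonoidAlgebra.mapDomainRingHom_apply,
    AddMonoidAlgebra.mapDomain_single]
  simp

/-- The group `𝓐_n`, to be made an `R`-module by `x * v = x^e v`. -/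
def TwistedBase (p n _e : ℕ) : Type := LampBase p n

instance (p n e : ℕ) : AddCommGroup (TwistedBase p n e) :=
  inferInstanceAs (AddCommGroup (LampBase p n))

/-- The `R`-module `𝓐_n^e`, in which `f(x) ∈ R` acts as multiplication by `f(x^e)`. -/
instance (p n e : ℕ) : Module (ZMod p)[T;T⁻¹] (TwistedBase p n e) :=
  Module.compHom (LampBase p n) (laurentExpand p e)

/-- `f = det* U`. Here `e = e(U)` is finite, `W` is `U` as a submodule of `𝓐_n^e`, the quotient
`𝓐_n^e ⧸ W` is a finite direct sum of modules `R ⧸ (q_i ^ r_i)` where each `q_i` is `0` or an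
irreducible polynomial over `𝔽_p` with `q_i(0) = 1`, and `f = ∏_{q_i ≠ 0} q_i ^ r_i`. -/
def IsDetStar {p n : ℕ} (U : AddSubgroup (LampBase p n)) (f : Polynomial (ZMod p)) : Prop :=
  0 < lampPeriod U ∧
  ∃ W : Submodule (ZMod p)[T;T⁻¹] (TwistedBase p n (lampPeriod U)),
    (W : Set (TwistedBase p n (lampPeriod U))) = (U : Set (LampBase p n)) ∧
    ∃ (N : ℕ) (q : Fin N → Polynomial (ZMod p)) (r : Fin N → ℕ),
      (∀ i, q i = 0 ∨ (Irreducible (q i) ∧ (q i).eval 0 = 1)) ∧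
      Nonempty ((TwistedBase p n (lampPeriod U) ⧸ W) ≃ₗ[(ZMod p)[T;T⁻¹]]
        (∀ i, (ZMod p)[T;T⁻¹] ⧸ Ideal.span {Polynomial.toLaurent (q i ^ r i)})) ∧
      f = ∏ i with q i ≠ 0, q i ^ r i

/-! `det* U` exists as soon as `e(U)` is finite, because `R` is a principal ideal domain. -/

theorem isPrincipalIdealRing_laurent {F : Type*} [Field F] : IsPrincipalIdealRing F[T;T⁻¹] := by
  constructor
  intro I
  have h := IsLocalization.map_under (Submonoid.powers (Polynomial.X : Polynomial F)) F[T;T⁻¹] I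
  rw [← h]
  obtain ⟨a, ha⟩ := IsPrincipalIdealRing.principal (I.under (Polynomial F))
  refine ⟨⟨algebraMap _ _ a, ?_⟩⟩
  rw [ha]
  change Ideal.map _ (Ideal.span {a}) = Ideal.span _
  rw [Ideal.map_span, Set.image_singleton]

open Polynomial in
theorem laurent_isUnit_of_toLaurent {F : Type*} [Field F] {a : F[X]} (h : IsUnit (toLaurent a)) (h0 : a.eval 0 ≠ 0) : IsUnit a := by
  obtain ⟨u, hu⟩ := h.exists_right_inv
  obtain ⟨m, u', hu'⟩ := u.exists_T_pow
  have h1 : a * u' = X ^ m := by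
    apply Polynomial.toLaurent_injective
    rw [map_mul, hu', ← mul_assoc, hu, one_mul, toLaurent_X_pow]
  obtain ⟨i, -, hi⟩ := (dvd_prime_pow prime_X m).1 (Dvd.intro _ h1)
  rcases Nat.eq_zero_or_pos i with rfl | hpos
  · rw [pow_zero] at hi
    exact associated_one_iff_isUnit.1 hi
  · exfalso
    apply h0
    have : X ∣ a := (dvd_pow_self X hpos.ne').trans hi.symm.dvd
    rw [X_dvd_iff, coeff_zero_eq_eval_zero] at this
    exact this

open Polynomial in
theorem exists_irreducible_toLaurent {F : Type*} [Field F] {f : F[T;T⁻¹]} (hf : Irreducible f) :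
    ∃ q : F[X], Irreducible q ∧ q.eval 0 = 1 ∧ Associated (toLaurent q) f := by
  obtain ⟨m, g, hg⟩ := f.exists_T_pow
  have hg0 : g ≠ 0 := by
    rintro rfl
    rw [map_zero] at hg
    have := (isUnit_T (R := F) (m : ℤ)).mul_left_eq_zero.1 hg.symm
    exact hf.ne_zero this
  obtain ⟨q, hq, hXq⟩ := Polynomial.exists_eq_pow_rootMultiplicity_mul_and_not_dvd g hg0 0
  rw [C_0, sub_zero] at hq hXq
  set j := g.rootMultiplicity 0
  have hc : q.eval 0 ≠ 0 := by
    rwa [X_dvd_iff, coeff_zero_eq_eval_zero] at hXq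
  have hCu : IsUnit (Polynomial.C (q.eval 0)⁻¹) := by simpa using hc
  have ha : Associated (toLaurent (Polynomial.C (q.eval 0)⁻¹ * q)) f := by
    have e1 : Associated (toLaurent (Polynomial.C (q.eval 0)⁻¹ * q)) (toLaurent q) := by
      rw [map_mul]
      exact (associated_isUnit_mul_left_iff (hCu.map toLaurent)).2 (Associated.refl _)
    have e2 : Associated (toLaurent g) (toLaurent q) := by
      rw [hq, map_mul, toLaurent_X_pow]
      exact (associated_isUnit_mul_left_iff (isUnit_T _)).2 (Associated.refl _)
    have e3 : Associated (toLaurent g) f := by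
      rw [hg]
      exact (associated_mul_isUnit_left_iff (isUnit_T _)).2 (Associated.refl _)
    exact e1.trans (e2.symm.trans e3)
  have h1 : (Polynomial.C (q.eval 0)⁻¹ * q).eval 0 = 1 := by simp [hc]
  refine ⟨_, ⟨?_, ?_⟩, h1, ha⟩
  · intro hu
    exact (ha.irreducible_iff.2 hf).not_isUnit (hu.map toLaurent)
  · intro a b hab
    have hab0 : a.eval 0 * b.eval 0 = 1 := by rw [← eval_mul, ← hab, h1]
    rcases (ha.irreducible_iff.2 hf).isUnit_or_isUnit (by rw [hab, map_mul]) with h | h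
    · exact Or.inl (laurent_isUnit_of_toLaurent h (left_ne_zero_of_mul_eq_one hab0))
    · exact Or.inr (laurent_isUnit_of_toLaurent h (right_ne_zero_of_mul_eq_one hab0))

theorem twisted_smul_def {p n e : ℕ} (f : (ZMod p)[T;T⁻¹]) (v : TwistedBase p n e) :
    f • v = (show TwistedBase p n e from laurentExpand p e f • (show LampBase p n from v)) := rfl

theorem laurentExpand_C (p e : ℕ) (a : ZMod p) :
    laurentExpand p e (C a) = C a := by
  have h := AddMonoidAlgebra.mapDomain_single (f := (nsmulAddMonoidHom e : ℤ →+ ℤ)) (a := (0 : ℤ))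
    (r := a)
  rw [map_zero] at h
  exact h

theorem twistedBase_finite (p n e : ℕ) (he : 0 < e) :
    Module.Finite (ZMod p)[T;T⁻¹] (TwistedBase p n e) := by
  let b : Fin n × Fin e → TwistedBase p n e := fun ij =>
    (Pi.single ij.1 (T (ij.2 : ℕ)) : LampBase p n)
  refine ⟨⟨(Set.finite_range b).toFinset, ?_⟩⟩
  rw [Set.Finite.coe_toFinset, eq_top_iff]
  rintro v -
  set S := Submodule.span (ZMod p)[T;T⁻¹] (Set.range b)
  have key : ∀ (i : Fin n) (f : (ZMod p)[T;T⁻¹]),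
      ((Pi.single i f : LampBase p n) : TwistedBase p n e) ∈ S := by
    intro i f
    induction f using LaurentPolynomial.induction_on' with
    | add f g hf hg =>
      have h : (Pi.single i (f + g) : LampBase p n) = Pi.single i f + Pi.single i g :=
        Pi.single_add (f := fun _ : Fin n => (ZMod p)[T;T⁻¹]) i f g
      rw [h]
      exact S.add_mem hf hg
    | C_mul_T m a =>
      have hm0 := Int.emod_nonneg m (b := (e : ℤ)) (by omega)
      have hm1 := Int.emod_lt_of_pos m (b := (e : ℤ)) (by omega)
      have hlt : (m % e).toNat < e := by omega
      have h : (Pi.single i (C a * T m) : LampBase p n) =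
          (C a * T (m / e) : (ZMod p)[T;T⁻¹]) • b (i, ⟨(m % e).toNat, hlt⟩) := by
        rw [twisted_smul_def, map_mul, laurentExpand_C, laurentExpand_T]
        change _ = (C a * T (e * (m / e)) : (ZMod p)[T;T⁻¹]) •
          (Pi.single i (T ((m % e).toNat : ℤ)) : LampBase p n)
        rw [← Pi.single_smul, smul_eq_mul, mul_assoc, ← T_add, Int.toNat_of_nonneg hm0,
          Int.mul_ediv_add_emod]
      rw [h]
      exact S.smul_mem _ (Submodule.subset_span ⟨_, rfl⟩)
  have hv : v = ((∑ i, Pi.single i ((show LampBase p n from v) i) : LampBase p n)) :=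
    (Finset.univ_sum_single (show LampBase p n from v)).symm
  rw [hv]
  exact Submodule.sum_mem (M := TwistedBase p n e) S (fun i _ => key i _)

theorem lampPeriod_spec {p n : ℕ} {U : AddSubgroup (LampBase p n)} (h : 0 < lampPeriod U) :
    U.map (lampShift p n (lampPeriod U)).toAddMonoidHom = U :=
  (Nat.sInf_mem (Nat.nonempty_of_pos_sInf h)).2

theorem laurentExpand_smul_mem {p n e : ℕ} {U : AddSubgroup (LampBase p n)}
    (h : U.map (lampShift p n e).toAddMonoidHom = U) (f : (ZMod p)[T;T⁻¹]) (u : LampBase p n)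
    (hu : u ∈ U) : laurentExpand p e f • u ∈ U := by
  have h1 : ∀ w ∈ U, (T (e : ℤ) : (ZMod p)[T;T⁻¹]) • w ∈ U := fun w hw => by
    rw [← h]; exact ⟨w, hw, rfl⟩
  have h2 : ∀ w ∈ U, (T (-e : ℤ) : (ZMod p)[T;T⁻¹]) • w ∈ U := fun w hw => by
    rw [← h] at hw
    obtain ⟨w', hw', rfl⟩ := hw
    have := (lampShift p n e).left_inv w'
    change (T (-e : ℤ) : (ZMod p)[T;T⁻¹]) • _ = w' at this
    exact this.symm ▸ hw'
  have h3 : ∀ (k : ℤ), ∀ w ∈ U, (T (e * k : ℤ) : (ZMod p)[T;T⁻¹]) • w ∈ U := by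
    intro k
    induction k using Int.induction_on with
    | zero => intro w hw; simpa using hw
    | succ k ih =>
      intro w hw
      rw [mul_add, mul_one, T_add, mul_smul]
      exact ih _ (h1 _ hw)
    | pred k ih =>
      intro w hw
      rw [mul_sub, mul_one, sub_eq_add_neg, T_add, mul_smul]
      exact ih _ (h2 _ hw)
  induction f using LaurentPolynomial.induction_on' with
  | add f g hf hg => rw [map_add, add_smul]; exact U.add_mem hf hg
  | C_mul_T m a =>
    rw [map_mul, laurentExpand_C, laurentExpand_T, mul_smul]
    have h4 := h3 m u hu
    have : (C a : (ZMod p)[T;T⁻¹]) = ((a.cast : ℤ) : (ZMod p)[T;T⁻¹]) := by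
      rw [← map_intCast (C : ZMod p →+* (ZMod p)[T;T⁻¹]), ZMod.intCast_cast, ZMod.cast_id]
    rw [this, Int.cast_smul_eq_zsmul]
    exact U.zsmul_mem h4 _

theorem exists_isDetStar {p n : ℕ} [Fact p.Prime] {U : AddSubgroup (LampBase p n)}
    (h : 0 < lampPeriod U) : ∃ f, IsDetStar U f := by
  classical
  let W : Submodule (ZMod p)[T;T⁻¹] (TwistedBase p n (lampPeriod U)) :=
    { carrier := (U : Set (LampBase p n))
      add_mem' := U.add_mem
      zero_mem' := U.zero_mem
      smul_mem' := fun f u hu => laurentExpand_smul_mem (lampPeriod_spec h) f u hu }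
  have := isPrincipalIdealRing_laurent (F := ZMod p)
  have := twistedBase_finite p n _ h
  obtain ⟨k, ι, _, P, hP, r, ⟨φ⟩⟩ := Module.equiv_free_prod_directSum
    (R := (ZMod p)[T;T⁻¹]) (M := TwistedBase p n (lampPeriod U) ⧸ W)
  choose q hq hq0 hqP using fun i => exists_irreducible_toLaurent (hP i)
  let Q : Fin k ⊕ ι → Polynomial (ZMod p) := Sum.elim (fun _ => 0) q
  let r' : Fin k ⊕ ι → ℕ := Sum.elim (fun _ => 1) r
  let ε := Fintype.equivFin (Fin k ⊕ ι)
  refine ⟨_, h, W, rfl, _, fun i => Q (ε.symm i), fun i => r' (ε.symm i), ?_, ?_, rfl⟩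
  · intro i
    change Q (ε.symm i) = 0 ∨ (Irreducible (Q (ε.symm i)) ∧ (Q (ε.symm i)).eval 0 = 1)
    rcases ε.symm i with j | j
    · exact Or.inl rfl
    · exact Or.inr ⟨hq j, hq0 j⟩
  · let M : Fin k ⊕ ι → Type := fun j =>
      (ZMod p)[T;T⁻¹] ⧸ Ideal.span {Polynomial.toLaurent (Q j ^ r' j)}
    let A : (Fin k →₀ (ZMod p)[T;T⁻¹]) ≃ₗ[(ZMod p)[T;T⁻¹]] (∀ i : Fin k, M (Sum.inl i)) :=
      (Finsupp.linearEquivFunOnFinite _ _ _).trans (LinearEquiv.piCongrRight fun i =>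
        (Submodule.quotEquivOfEqBot _ (by simp [Q, r'])).symm)
    let B : (DirectSum ι fun i => (ZMod p)[T;T⁻¹] ⧸ Submodule.span (ZMod p)[T;T⁻¹] {P i ^ r i})
        ≃ₗ[(ZMod p)[T;T⁻¹]] (∀ i : ι, M (Sum.inr i)) :=
      (DirectSum.linearEquivFunOnFintype _ _ _).trans (LinearEquiv.piCongrRight fun i =>
        Submodule.quotEquivOfEq _ _ (by
          refine (Ideal.span_singleton_eq_span_singleton.2 ?_).symm
          simp only [Q, r', Sum.elim_inr, map_pow]
          exact (hqP i).pow_pow))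
    exact ⟨φ.trans ((A.prodCongr B).trans ((LinearEquiv.sumPiEquivProdPi _ _ _ M).symm.trans
      (LinearEquiv.piCongrLeft' _ M ε)))⟩

open Classical in
/-- `det* U ∈ 𝔽_p[x]`, for `U` with `e(U)` finite (and the junk value `0` otherwise). It is
unique by the structure theorem for finitely generated modules over a principal ideal domain. -/
def detStar {p n : ℕ} (U : AddSubgroup (LampBase p n)) : Polynomial (ZMod p) :=
  if h : ∃ f, IsDetStar U f then h.choose else 0

theorem isDetStar_detStar {p n : ℕ} [Fact p.Prime] {U : AddSubgroup (LampBase p n)}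
    (h : 0 < lampPeriod U) : IsDetStar U (detStar U) := by
  rw [detStar, dif_pos (exists_isDetStar h)]
  exact (exists_isDetStar h).choose_spec

end

noncomputable section

/-! ### Divisibility by `x^k - 1` -/

/-! In characteristic `p`, `x^(p^m) - 1 = (x - 1)^(p^m)`. The kernels of the reductions to `(ℤ/p)^n
≀ ℤ/p^m` are cofinal among the normal subgroups of `p`-power index (`ker_lampReduction_le`), so `V`
is closed iff it contains every `(w, j)` approximable by elements of `V`, `p`-adically in `j` and
`(x - 1)`-adically in `w`. On `𝓐_n` this topology is the one induced from `𝔽_p[[ℤ_p]]^n`, which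
settles `s = 0`.

Let `s > 0` and let `a` be the `p`-adic valuation of `s`. If `V` is closed, so is `V₀`. Multiples of
`s` are `p`-adically dense in `p^a ℤ`, so the `x^s`-invariant group `V₀`, being closed, is
`x^(p^a)`-invariant, and `e(V₀)` is some `p^b`. Closedness of `V₀` then means that the twisted
module `𝓐_n/V₀` is separated for powers of `x - 1`. A summand `R/q^r` is separated exactly when `q =
0`, `r = 0` or `q = 1 - x`; this is the determinant condition (`isAdicClosed_iff_detStar`).

With `V₀` closed, `V` can fail to be closed only through a limit `(w, q)` with `0 < q < s`. Write
`(v, s)^k = (v_k, sk)`, where `(x^s - 1) v_k = (x^(sk) - 1) v`. As `sk → q`, the limit satisfies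
`(x^s - 1) w = (x^q - 1) v` up to `(x^s - 1) V₀`. Up to a unit of the completion `x^s - 1` is `(x -
1)^(p^a)`, so the error becomes an element of `(x - 1)^(p^a) V₀`: exactly the excluded relation
(`not_exists_of_closed`, `closed_of_forall_not_exists`). -/

theorem T_sub_one_dvd_T_mul_sub_one {F : Type*} [CommRing F] (a k : ℤ) :
    (T a - 1 : F[T;T⁻¹]) ∣ T (a * k) - 1 := by
  have key : ∀ k : ℕ, (T a - 1 : F[T;T⁻¹]) ∣ T (a * k) - 1 := fun k => by
    rw [mul_comm, ← T_pow]
    exact sub_one_dvd_pow_sub_one _ _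
  obtain ⟨m, rfl | rfl⟩ := k.eq_nat_or_neg
  · exact key m
  · have h : (T (a * -m) - 1 : F[T;T⁻¹]) = -T (a * -m) * (T (a * m) - 1) := by
      rw [neg_mul, mul_sub, ← T_add, mul_neg, neg_add_cancel, T_zero]
      ring
    rw [h]
    exact (key m).mul_left _

theorem T_sub_one_dvd_T_sub_T {F : Type*} [CommRing F] {a j k : ℤ} (h : a ∣ j - k) :
    (T a - 1 : F[T;T⁻¹]) ∣ T j - T k := by
  obtain ⟨c, hc⟩ := h
  have : (T j - T k : F[T;T⁻¹]) = T k * (T (a * c) - 1) := by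
    rw [mul_sub, ← T_add, ← hc, mul_one, add_sub_cancel]
  rw [this]
  exact (T_sub_one_dvd_T_mul_sub_one a c).mul_left _

instance laurentPolynomial_zmod_charP (p : ℕ) [Fact p.Prime] : CharP (ZMod p)[T;T⁻¹] p :=
  charP_of_injective_ringHom (f := (C : ZMod p →+* (ZMod p)[T;T⁻¹]))
    (RingHom.injective _) p

theorem T_pow_char_sub_one (p : ℕ) [Fact p.Prime] (m : ℕ) :
    (T ((p ^ m : ℕ) : ℤ) - 1 : (ZMod p)[T;T⁻¹]) = (T 1 - 1) ^ p ^ m := by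
  rw [sub_pow_char_pow, one_pow, T_pow, mul_one]

theorem not_isUnit_T_one_sub_one (p : ℕ) [Fact p.Prime] :
    ¬ IsUnit (T 1 - 1 : (ZMod p)[T;T⁻¹]) := by
  intro h
  have h1 : (T 1 - 1 : (ZMod p)[T;T⁻¹]) = Polynomial.toLaurent (Polynomial.X - Polynomial.C 1) := by
    simp
  rw [h1] at h
  exact Polynomial.not_isUnit_X_sub_C 1 (laurent_isUnit_of_toLaurent h (by simp))

theorem T_one_sub_one_ne_zero (p : ℕ) [Fact p.Prime] : (T 1 - 1 : (ZMod p)[T;T⁻¹]) ≠ 0 := by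
  have h1 : (T 1 - 1 : (ZMod p)[T;T⁻¹]) = Polynomial.toLaurent (Polynomial.X - Polynomial.C 1) := by
    simp
  rw [h1, Ne, Polynomial.toLaurent_eq_zero]
  exact Polynomial.X_sub_C_ne_zero 1

theorem eq_zero_of_forall_T_one_sub_one_pow_dvd {p : ℕ} [Fact p.Prime] {f : (ZMod p)[T;T⁻¹]}
    (h : ∀ m : ℕ, (T 1 - 1 : (ZMod p)[T;T⁻¹]) ^ m ∣ f) : f = 0 := by
  have := isPrincipalIdealRing_laurent (F := ZMod p)
  by_contra hf
  obtain ⟨m, hm⟩ := FiniteMultiplicity.of_not_isUnit (not_isUnit_T_one_sub_one p) hf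
  exact hm (h _)

theorem laurentExpand_T_one_sub_one_pow (p : ℕ) [Fact p.Prime] (b m : ℕ) :
    laurentExpand p (p ^ b) ((T 1 - 1) ^ m) = (T 1 - 1) ^ (p ^ b * m) := by
  rw [map_pow, map_sub, map_one, laurentExpand_T, mul_one, T_pow_char_sub_one, pow_mul]

/-! ### Subgroups of `𝓐_n` that are closed in the `(x - 1)`-adic topology -/

/-- `U` is closed in the topology of `𝓐_n` defined by the subgroups `(x^(p^m) - 1) 𝓐_n`. -/
def IsAdicClosed {p n : ℕ} (U : AddSubgroup (LampBase p n)) : Prop :=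
  ∀ w : LampBase p n,
    (∀ m : ℕ, ∃ u ∈ U, ∃ z : LampBase p n, w = u + (T 1 - 1 : (ZMod p)[T;T⁻¹]) ^ p ^ m • z) → w ∈ U

/-- Only cofinality of the exponents matters. This absorbs the losses of `p^a` and the factors `p^b`
arising below. -/
theorem isAdicClosed_iff {p n : ℕ} [hp : Fact p.Prime] {U : AddSubgroup (LampBase p n)} {k : ℕ → ℕ}
    (hk : ∀ m, m ≤ k m) :
    IsAdicClosed U ↔ ∀ w : LampBase p n,
      (∀ m : ℕ, ∃ u ∈ U, ∃ z : LampBase p n, w = u + (T 1 - 1 : (ZMod p)[T;T⁻¹]) ^ k m • z) →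
        w ∈ U := by
  have key : ∀ {i j : ℕ} {w : LampBase p n}, i ≤ j →
      (∃ u ∈ U, ∃ z : LampBase p n, w = u + (T 1 - 1 : (ZMod p)[T;T⁻¹]) ^ j • z) →
      ∃ u ∈ U, ∃ z : LampBase p n, w = u + (T 1 - 1 : (ZMod p)[T;T⁻¹]) ^ i • z := by
    rintro i j w hij ⟨u, hu, z, rfl⟩
    exact ⟨u, hu, (T 1 - 1 : (ZMod p)[T;T⁻¹]) ^ (j - i) • z, by
      rw [smul_smul, ← pow_add, Nat.add_sub_cancel' hij]⟩
  refine forall_congr' fun w => imp_congr_left ⟨fun h m => ?_, fun h m => ?_⟩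
  · exact key (Nat.lt_pow_self hp.out.one_lt).le (h (k m))
  · exact key (hk _) (h (p ^ m))

theorem eq_zero_of_forall_eq_pow_smul {p n : ℕ} [Fact p.Prime] {w : LampBase p n}
    (h : ∀ m : ℕ, ∃ z : LampBase p n, w = (T 1 - 1 : (ZMod p)[T;T⁻¹]) ^ m • z) : w = 0 := by
  funext i
  refine eq_zero_of_forall_T_one_sub_one_pow_dvd fun m => ?_
  obtain ⟨z, hz⟩ := h m
  exact ⟨z i, by rw [hz]; rfl⟩

theorem isAdicClosed_bot {p n : ℕ} [Fact p.Prime] :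
    IsAdicClosed (⊥ : AddSubgroup (LampBase p n)) := by
  rw [isAdicClosed_iff (k := id) fun _ => le_rfl]
  intro w h
  refine eq_zero_of_forall_eq_pow_smul fun m => ?_
  obtain ⟨u, hu, z, hz⟩ := h m
  exact ⟨z, by rw [hz, AddSubgroup.mem_bot.1 hu, zero_add]; rfl⟩

/-! ### The finite quotients `𝔽_p[ℤ/p^m]^n ⋊ ℤ/p^m` -/

/-- The reduction `R = 𝔽_p[ℤ] → 𝔽_p[ℤ/p^m]`. -/
def cyclicReduction (p m : ℕ) :
    (ZMod p)[T;T⁻¹] →+* AddMonoidAlgebra (ZMod p) (ZMod (p ^ m)) :=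
  AddMonoidAlgebra.mapDomainRingHom (ZMod p) (Int.castAddHom (ZMod (p ^ m)))

theorem cyclicReduction_C_mul_T (p m : ℕ) (a : ZMod p) (k : ℤ) :
    cyclicReduction p m (C a * T k) = AddMonoidAlgebra.single (k : ZMod (p ^ m)) a := by
  rw [← single_eq_C_mul_T, cyclicReduction, AddMonoidAlgebra.mapDomainRingHom_apply]
  exact AddMonoidAlgebra.mapDomain_single

theorem cyclicReduction_T (p m : ℕ) (k : ℤ) :
    cyclicReduction p m (T k) = AddMonoidAlgebra.single (k : ZMod (p ^ m)) 1 := by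
  rw [← cyclicReduction_C_mul_T, map_one, one_mul]

theorem cyclicReduction_eq_zero_iff {p m : ℕ} [hp : Fact p.Prime] {f : (ZMod p)[T;T⁻¹]} :
    cyclicReduction p m f = 0 ↔ (T 1 - 1 : (ZMod p)[T;T⁻¹]) ^ p ^ m ∣ f := by
  rw [← T_pow_char_sub_one]
  constructor
  · intro h
    -- An additive section using exponents in `[0, p^m)`: every `f` is congruent modulo `x^(p^m) -
    -- 1` to the lift of its reduction, which vanishes if the reduction does.
    let σ : AddMonoidAlgebra (ZMod p) (ZMod (p ^ m)) → (ZMod p)[T;T⁻¹] :=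
      AddMonoidAlgebra.mapDomain fun a => (a.val : ℤ)
    have hσ : ∀ f : (ZMod p)[T;T⁻¹],
        (T ((p ^ m : ℕ) : ℤ) - 1 : (ZMod p)[T;T⁻¹]) ∣ f - σ (cyclicReduction p m f) := by
      intro f
      induction f using LaurentPolynomial.induction_on' with
      | add f g hf hg =>
        have : σ (cyclicReduction p m (f + g)) =
            σ (cyclicReduction p m f) + σ (cyclicReduction p m g) := by
          rw [map_add]
          exact AddMonoidAlgebra.mapDomain_add _ _ _
        rw [this, add_sub_add_comm]
        exact dvd_add hf hg
      | C_mul_T k a =>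
        have : σ (cyclicReduction p m (C a * T k)) = C a * T ((k : ZMod (p ^ m)).val : ℤ) := by
          rw [cyclicReduction_C_mul_T, ← single_eq_C_mul_T]
          exact AddMonoidAlgebra.mapDomain_single
        rw [this, ← mul_sub]
        have := hp.out.pos
        have : NeZero (p ^ m) := ⟨by positivity⟩
        refine (T_sub_one_dvd_T_sub_T ?_).mul_left _
        rw [← ZMod.intCast_zmod_eq_zero_iff_dvd]
        simp
    have h0 : σ 0 = 0 := AddMonoidAlgebra.mapDomain_zero _
    simpa [h, h0] using hσ f
  · rintro ⟨g, rfl⟩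
    rw [map_mul, map_sub, cyclicReduction_T, map_one]
    have : (((p ^ m : ℕ) : ℤ) : ZMod (p ^ m)) = 0 := by
      rw [Int.cast_natCast, ZMod.natCast_self]
    rw [this, AddMonoidAlgebra.one_def, sub_self, zero_mul]

theorem cyclicReduction_comp_eq_zero_iff {p m n : ℕ} [Fact p.Prime] {w : LampBase p n} :
    (∀ i, cyclicReduction p m (w i) = 0) ↔
      ∃ z : LampBase p n, w = (T 1 - 1 : (ZMod p)[T;T⁻¹]) ^ p ^ m • z := by
  simp only [cyclicReduction_eq_zero_iff]
  constructor
  · intro h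
    choose z hz using h
    exact ⟨z, funext hz⟩
  · rintro ⟨z, rfl⟩ i
    exact ⟨z i, rfl⟩

/-- The shift action of `ℤ/p^m` on `𝔽_p[ℤ/p^m]^n`. -/
def cyclicLampAction (p n m : ℕ) : Multiplicative (ZMod (p ^ m)) →*
    MulAut (Multiplicative (Fin n → AddMonoidAlgebra (ZMod p) (ZMod (p ^ m)))) :=
  (MulAutMultiplicative _).symm.toMonoidHom.comp
    ((DistribMulAction.toAddAut (AddMonoidAlgebra (ZMod p) (ZMod (p ^ m)))ˣ
      (Fin n → AddMonoidAlgebra (ZMod p) (ZMod (p ^ m)))).comp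
        (AddMonoidAlgebra.of (ZMod p) (ZMod (p ^ m))).toHomUnits)

/-- The group `(ℤ/p)^n ≀ ℤ/p^m`. -/
abbrev CyclicLamplighter (p n m : ℕ) : Type :=
  SemidirectProduct (Multiplicative (Fin n → AddMonoidAlgebra (ZMod p) (ZMod (p ^ m))))
    (Multiplicative (ZMod (p ^ m))) (cyclicLampAction p n m)

/-- The reduction `(ℤ/p)^n ≀ ℤ → (ℤ/p)^n ≀ ℤ/p^m`. -/
def lampReduction (p n m : ℕ) : Lamplighter p n →* CyclicLamplighter p n m :=
  SemidirectProduct.map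
    (AddMonoidHom.toMultiplicative ((cyclicReduction p m).toAddMonoidHom.compLeft (Fin n)))
    (AddMonoidHom.toMultiplicative (Int.castAddHom (ZMod (p ^ m)))) (fun k => by
      refine MonoidHom.ext fun w => ?_
      change Multiplicative.ofAdd (fun i => cyclicReduction p m (T k.toAdd * w.toAdd i)) =
        Multiplicative.ofAdd (fun i => AddMonoidAlgebra.single ((k.toAdd : ℤ) : ZMod (p ^ m)) 1 *
          cyclicReduction p m (w.toAdd i))
      simp only [map_mul, cyclicReduction_T])

theorem lampElt_mem_ker_lampReduction {p n m : ℕ} [Fact p.Prime] {w : LampBase p n} {j : ℤ} :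
    lampElt w j ∈ (lampReduction p n m).ker ↔
      (∃ z : LampBase p n, w = (T 1 - 1 : (ZMod p)[T;T⁻¹]) ^ p ^ m • z) ∧ ((p ^ m : ℕ) : ℤ) ∣ j := by
  rw [MonoidHom.mem_ker, ← cyclicReduction_comp_eq_zero_iff, ← ZMod.intCast_zmod_eq_zero_iff_dvd,
    SemidirectProduct.ext_iff]
  exact and_congr (funext_iff (f := fun i => cyclicReduction p m (w i)) (g := 0))
    (Iff.of_eq (rfl : (((j : ℤ) : ZMod (p ^ m)) = 0) = _))

theorem index_ker_lampReduction (p n m : ℕ) [hp : Fact p.Prime] :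
    ∃ k : ℕ, (lampReduction p n m).ker.index = p ^ k := by
  have := hp.out.pos
  have : NeZero (p ^ m) := ⟨by positivity⟩
  have h : Nat.card (CyclicLamplighter p n m) = p ^ (p ^ m * n + m) := by
    rw [SemidirectProduct.card, Nat.card_congr Multiplicative.toAdd, Nat.card_fun,
      Nat.card_congr Multiplicative.toAdd,
      Nat.card_congr AddMonoidAlgebra.coeffEquiv, Nat.card_congr Finsupp.equivFunOnFinite,
      Nat.card_fun]
    simp [← pow_mul, pow_add]
  have h2 := Subgroup.card_subgroup_dvd_card (lampReduction p n m).range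
  rw [h, Nat.dvd_prime_pow hp.out] at h2
  obtain ⟨k, -, hk⟩ := h2
  exact ⟨k, by rw [Subgroup.index_ker, hk]⟩

/-- If `N` has index `p^M` and `m ≥ M`, then `(0, 1)^(p^m)` lies in `N`. By normality its
commutators with the base do too, and these are the elements `((x^(p^m) - 1) z, 0)`. Together they
give the whole kernel. -/
theorem ker_lampReduction_le {p n : ℕ} [Fact p.Prime] (N : PPowerNormal p (Lamplighter p n)) :
    ∃ M : ℕ, ∀ m, M ≤ m → (lampReduction p n m).ker ≤ N.1 := by
  obtain ⟨hN, M, hM⟩ := N.2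
  refine ⟨M, fun m hm g hg => ?_⟩
  obtain ⟨w, j, rfl⟩ : ∃ w j, g = lampElt w j := ⟨g.left.toAdd, g.right.toAdd, rfl⟩
  obtain ⟨⟨z, rfl⟩, c, rfl⟩ := lampElt_mem_ker_lampReduction.1 hg
  have hT : ∀ k : ℕ, (lampElt (0 : LampBase p n) 1) ^ k = lampElt 0 k := by
    intro k
    induction k with
    | zero => rfl
    | succ k ih => rw [pow_succ, ih, lampElt_mul]; simp
  have hTM : lampElt (0 : LampBase p n) ((p ^ m : ℕ) : ℤ) ∈ N.1 := by
    rw [← hT, ← Nat.add_sub_cancel' hm, pow_add, pow_mul]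
    refine N.1.pow_mem ?_ _
    rw [← hM]
    exact N.1.pow_index_mem _
  have hz : lampElt (0 : LampBase p n) (((p ^ m : ℕ) : ℤ) * c) ∈ N.1 := by
    have hc : ∀ c : ℤ, lampElt (0 : LampBase p n) (((p ^ m : ℕ) : ℤ) * c) =
        lampElt (0 : LampBase p n) ((p ^ m : ℕ) : ℤ) ^ c := by
      intro c
      induction c using Int.induction_on with
      | zero => simp; rfl
      | succ k ih =>
        rw [zpow_add_one, ← ih, lampElt_mul, mul_add, mul_one]; simp
      | pred k ih =>
        rw [zpow_sub_one, ← ih, eq_mul_inv_iff_mul_eq, lampElt_mul]; simp [mul_sub]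
    rw [hc]
    exact N.1.zpow_mem hTM c
  have hcomm : lampElt ((T 1 - 1 : (ZMod p)[T;T⁻¹]) ^ p ^ m • z) 0 ∈ N.1 := by
    have h1 : lampElt (-z) 0 * lampElt (0 : LampBase p n) ((p ^ m : ℕ) : ℤ) * (lampElt (-z) 0)⁻¹ *
        (lampElt (0 : LampBase p n) ((p ^ m : ℕ) : ℤ))⁻¹ =
        lampElt ((T 1 - 1 : (ZMod p)[T;T⁻¹]) ^ p ^ m • z) 0 := by
      rw [mul_inv_eq_iff_eq_mul, mul_inv_eq_iff_eq_mul, lampElt_mul, lampElt_mul, lampElt_mul,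
        ← T_pow_char_sub_one]
      congr 1
      · simp [sub_smul]
        abel
    rw [← h1]
    exact N.1.mul_mem (hN.conj_mem _ hTM _) (N.1.inv_mem hTM)
  have := N.1.mul_mem hcomm hz
  rwa [lampElt_mul, smul_zero, add_zero, zero_add] at this

/-! ### Closed subgroups in terms of congruences -/

/-- `(w, j) ∈ V N_m` for every `m`, where `N_m` is the kernel of the reduction to
`(ℤ/p)^n ≀ ℤ/p^m`. -/
def InLampClosure {p n : ℕ} (V : Subgroup (Lamplighter p n)) (w : LampBase p n) (j : ℤ) : Prop :=
  ∀ m : ℕ, ∃ (u z : LampBase p n) (i : ℤ), lampElt u i ∈ V ∧ ((p ^ m : ℕ) : ℤ) ∣ j - i ∧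
    w = u + (T 1 - 1 : (ZMod p)[T;T⁻¹]) ^ p ^ m • z

theorem mk_ker_lampReduction_eq_iff {p n m : ℕ} [Fact p.Prime] {u w : LampBase p n} {i j : ℤ} :
    (lampElt u i)⁻¹ * lampElt w j ∈ (lampReduction p n m).ker ↔
      ((p ^ m : ℕ) : ℤ) ∣ j - i ∧
        ∃ z : LampBase p n, w = u + (T 1 - 1 : (ZMod p)[T;T⁻¹]) ^ p ^ m • z := by
  have h : (lampElt u i)⁻¹ * lampElt w j =
      lampElt ((T (-i) : (ZMod p)[T;T⁻¹]) • (w - u)) (j - i) := by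
    rw [inv_mul_eq_iff_eq_mul, lampElt_mul, smul_smul, ← T_add]
    simp
  rw [h, lampElt_mem_ker_lampReduction, and_comm]
  refine and_congr_right fun _ => ⟨?_, ?_⟩
  · rintro ⟨z, hz⟩
    refine ⟨(T i : (ZMod p)[T;T⁻¹]) • z, ?_⟩
    rw [smul_comm, ← hz, smul_smul, ← T_add]
    simp
  · rintro ⟨z, rfl⟩
    refine ⟨(T (-i) : (ZMod p)[T;T⁻¹]) • z, ?_⟩
    rw [add_sub_cancel_left, smul_comm]

theorem lampElt_eta {p n : ℕ} (g : Lamplighter p n) : ∃ w j, g = lampElt w j :=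
  ⟨g.left.toAdd, g.right.toAdd, rfl⟩

theorem lampElt_injective {p n : ℕ} {u w : LampBase p n} {i j : ℤ}
    (h : lampElt u i = lampElt w j) : u = w ∧ i = j :=
  ⟨congrArg (fun g => g.left.toAdd) h, congrArg (fun g => g.right.toAdd) h⟩

theorem ProPCompletion.of_mem_closure_iff {p n : ℕ} [Fact p.Prime]
    {V : Subgroup (Lamplighter p n)} {w : LampBase p n} {j : ℤ} :
    ProPCompletion.of p _ (lampElt w j) ∈ closure (ProPCompletion.of p _ '' V) ↔
      InLampClosure V w j := by
  constructor
  · intro h m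
    let N : PPowerNormal p (Lamplighter p n) :=
      ⟨(lampReduction p n m).ker, inferInstance, index_ker_lampReduction p n m⟩
    let O : Set (ProPCompletion p (Lamplighter p n)) :=
      {f | f.1 N = (lampElt w j : Lamplighter p n ⧸ N.1)}
    have hO : IsOpen O := by
      let (M : PPowerNormal p (Lamplighter p n)) : TopologicalSpace (Lamplighter p n ⧸ M.1) := ⊥
      have hc : Continuous fun f : ProPCompletion p (Lamplighter p n) => f.1 N :=
        (continuous_apply N).comp continuous_induced_dom
      have : DiscreteTopology (Lamplighter p n ⧸ N.1) := ⟨rfl⟩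
      exact (isOpen_discrete {_}).preimage hc
    obtain ⟨_, hf, g, hg, rfl⟩ := mem_closure_iff.1 h O hO rfl
    obtain ⟨u, i, rfl⟩ := lampElt_eta g
    have := QuotientGroup.eq.1 hf
    obtain ⟨h1, z, hz⟩ := mk_ker_lampReduction_eq_iff.1 this
    exact ⟨u, z, i, hg, h1, hz⟩
  · intro h
    choose u z i hV hi hz using h
    let (M : PPowerNormal p (Lamplighter p n)) : TopologicalSpace (Lamplighter p n ⧸ M.1) := ⊥
    refine mem_closure_of_tendsto (b := Filter.atTop)
      (f := fun m => ProPCompletion.of p _ (lampElt (u m) (i m))) ?_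
      (Filter.Eventually.of_forall fun m => ⟨_, hV m, rfl⟩)
    rw [nhds_induced, Filter.tendsto_comap_iff, tendsto_pi_nhds]
    intro N
    obtain ⟨M, hM⟩ := ker_lampReduction_le N
    refine tendsto_nhds_of_eventually_eq ?_
    filter_upwards [Filter.eventually_ge_atTop M] with m hm
    exact QuotientGroup.eq.2 (hM m hm (mk_ker_lampReduction_eq_iff.2 ⟨hi m, z m, hz m⟩))

theorem eq_of_forall_pow_dvd_sub {p : ℕ} [hp : Fact p.Prime] {i j : ℤ}
    (h : ∀ m : ℕ, ((p ^ m : ℕ) : ℤ) ∣ j - i) : i = j := by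
  obtain ⟨m, hm⟩ : ∃ m, (j - i).natAbs < p ^ m := ⟨_, Nat.lt_pow_self hp.out.one_lt⟩
  have := Int.eq_zero_of_dvd_of_natAbs_lt_natAbs (h m) (by simpa using hm)
  omega

/-- `𝓛_n` is residually a finite `p`-group, so closedness in the completion can be tested on
elements of `𝓛_n` itself. -/
theorem ProPCompletion.of_lamplighter_injective (p n : ℕ) [Fact p.Prime] :
    Function.Injective (ProPCompletion.of p (Lamplighter p n)) := by
  intro g h hgh
  obtain ⟨u, i, rfl⟩ := lampElt_eta g
  obtain ⟨w, j, rfl⟩ := lampElt_eta h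
  have key : ∀ m : ℕ, ((p ^ m : ℕ) : ℤ) ∣ j - i ∧
        ∃ z : LampBase p n, w = u + (T 1 - 1 : (ZMod p)[T;T⁻¹]) ^ p ^ m • z := fun m =>
    mk_ker_lampReduction_eq_iff.1 (QuotientGroup.eq.1 (congrFun (congrArg Subtype.val hgh)
      ⟨(lampReduction p n m).ker, inferInstance, index_ker_lampReduction p n m⟩))
  have h1 : w - u = 0 := isAdicClosed_bot _ fun m => by
    obtain ⟨z, hz⟩ := (key m).2
    exact ⟨0, rfl, z, by rw [hz]; abel⟩
  rw [sub_eq_zero.1 h1, eq_of_forall_pow_dvd_sub fun m => (key m).1]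

theorem isProPClosed_iff {p n : ℕ} [Fact p.Prime] {V : Subgroup (Lamplighter p n)} :
    IsProPClosed p V ↔ ∀ w j, InLampClosure V w j → lampElt w j ∈ V := by
  constructor
  · intro h w j hw
    have : ProPCompletion.of p _ (lampElt w j) ∈ ProPCompletion.of p _ '' (V : Set _) := by
      rw [h]
      exact ⟨ProPCompletion.of_mem_closure_iff.2 hw, _, rfl⟩
    exact (ProPCompletion.of_lamplighter_injective p n).mem_set_image.1 this
  · intro h
    refine Set.Subset.antisymm (fun f hf => ⟨subset_closure hf, Set.image_subset_range _ _ hf⟩) ?_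
    rintro _ ⟨hf, g, rfl⟩
    obtain ⟨w, j, rfl⟩ := lampElt_eta g
    exact ⟨_, h w j (ProPCompletion.of_mem_closure_iff.1 hf), rfl⟩

theorem lampBaseToCompleted_apply_eq_iff {p n m : ℕ} [Fact p.Prime] {u w : LampBase p n} :
    (∀ i, (lampBaseToCompleted p n u i).1 m = (lampBaseToCompleted p n w i).1 m) ↔
      ∃ z : LampBase p n, w = u + (T 1 - 1 : (ZMod p)[T;T⁻¹]) ^ p ^ m • z := by
  have h1 : ∀ i, (lampBaseToCompleted p n u i).1 m = (lampBaseToCompleted p n w i).1 m ↔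
      cyclicReduction p m ((w - u) i) = 0 := fun i => by
    rw [Pi.sub_apply, map_sub, sub_eq_zero, eq_comm]
    rfl
  rw [forall_congr' h1, cyclicReduction_comp_eq_zero_iff]
  simp only [sub_eq_iff_eq_add']

theorem lampBaseToCompleted_mem_closure_iff {p n : ℕ} [Fact p.Prime]
    {U : AddSubgroup (LampBase p n)} {w : LampBase p n} :
    lampBaseToCompleted p n w ∈ closure (lampBaseToCompleted p n '' U) ↔
      ∀ m : ℕ, ∃ u ∈ U, ∃ z : LampBase p n,
        w = u + (T 1 - 1 : (ZMod p)[T;T⁻¹]) ^ p ^ m • z := by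
  constructor
  · intro h m
    let O : Set (Fin n → CompletedGroupAlgebra p) :=
      {f | ∀ i, (f i).1 m = (lampBaseToCompleted p n w i).1 m}
    have hO : IsOpen O := by
      let (k : ℕ) : TopologicalSpace (AddMonoidAlgebra (ZMod p) (ZMod (p ^ k))) := ⊥
      have : DiscreteTopology (AddMonoidAlgebra (ZMod p) (ZMod (p ^ m))) := ⟨rfl⟩
      have hc : ∀ i, Continuous fun f : Fin n → CompletedGroupAlgebra p => (f i).1 m := fun i =>
        ((continuous_apply m).comp continuous_induced_dom).comp (continuous_apply i)
      simp only [O, Set.ofPred_forall]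
      exact isOpen_iInter_of_finite fun i => (isOpen_discrete {_}).preimage (hc i)
    obtain ⟨_, hf, u, hu, rfl⟩ := mem_closure_iff.1 h O hO fun _ => rfl
    exact ⟨u, hu, lampBaseToCompleted_apply_eq_iff.1 hf⟩
  · intro h
    choose u hu z hz using h
    let (k : ℕ) : TopologicalSpace (AddMonoidAlgebra (ZMod p) (ZMod (p ^ k))) := ⊥
    refine mem_closure_of_tendsto (b := Filter.atTop) (f := fun m => lampBaseToCompleted p n (u m))
      ?_ (Filter.Eventually.of_forall fun m => ⟨_, hu m, rfl⟩)
    rw [tendsto_pi_nhds]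
    intro i
    rw [nhds_induced, Filter.tendsto_comap_iff, tendsto_pi_nhds]
    intro k
    refine tendsto_nhds_of_eventually_eq ?_
    filter_upwards [Filter.eventually_ge_atTop k] with m hm
    refine lampBaseToCompleted_apply_eq_iff.2
      ⟨(T 1 - 1 : (ZMod p)[T;T⁻¹]) ^ (p ^ m - p ^ k) • z m, ?_⟩ i
    rw [smul_smul, ← pow_add, Nat.add_sub_cancel' (Nat.pow_le_pow_right (NeZero.pos p) hm)]
    exact hz m

theorem lampBaseToCompleted_injective (p n : ℕ) [Fact p.Prime] :
    Function.Injective (lampBaseToCompleted p n) := by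
  intro u w h
  refine (sub_eq_zero.1 (isAdicClosed_bot (w - u) fun m => ?_)).symm
  obtain ⟨z, hz⟩ := lampBaseToCompleted_apply_eq_iff.1 fun i =>
    congrFun (congrArg Subtype.val (congrFun h i)) m
  exact ⟨0, rfl, z, by rw [hz]; abel⟩

theorem isClosedInCompleted_iff {p n : ℕ} [Fact p.Prime] {U : AddSubgroup (LampBase p n)} :
    IsClosedInCompleted U ↔ IsAdicClosed U := by
  constructor
  · intro h w hw
    have : lampBaseToCompleted p n w ∈ lampBaseToCompleted p n '' (U : Set _) := by
      rw [h]
      exact ⟨lampBaseToCompleted_mem_closure_iff.2 hw, _, rfl⟩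
    exact (lampBaseToCompleted_injective p n).mem_set_image.1 this
  · intro h
    refine Set.Subset.antisymm (fun f hf => ⟨subset_closure hf, Set.image_subset_range _ _ hf⟩) ?_
    rintro _ ⟨hf, w, rfl⟩
    exact ⟨_, h w (lampBaseToCompleted_mem_closure_iff.1 hf), rfl⟩

/-! ### The elements of a subgroup with a given triple -/

/-- Comparing the two products of `(v, s)` with its own power, which commute, gives the relation. It
replaces the geometric sum for `v_k` and covers negative `k` uniformly. -/
theorem exists_lampElt_zpow {p n : ℕ} (v : LampBase p n) (s k : ℤ) :
    ∃ vk : LampBase p n, lampElt v s ^ k = lampElt vk (s * k) ∧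
      (T s - 1 : (ZMod p)[T;T⁻¹]) • vk = (T (s * k) - 1 : (ZMod p)[T;T⁻¹]) • v := by
  obtain ⟨vk, j, h⟩ := lampElt_eta (lampElt v s ^ k)
  have hj : j = s * k := by
    have := congrArg (fun g => (SemidirectProduct.rightHom g).toAdd) h
    rw [map_zpow] at this
    change k • s = j at this
    rw [← this, smul_eq_mul, mul_comm]
  subst hj
  refine ⟨vk, h, ?_⟩
  have hc := ((Commute.refl (lampElt v s)).zpow_right k).eq
  rw [h, lampElt_mul, lampElt_mul] at hc
  rw [sub_smul, sub_smul, one_smul, one_smul, sub_eq_sub_iff_add_eq_add, add_comm,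
    (lampElt_injective hc).1, add_comm]

namespace IsLampTriple

variable {p n s : ℕ} {V : Subgroup (Lamplighter p n)} {V₀ : AddSubgroup (LampBase p n)}
  {v : LampBase p n}

theorem dvd_of_mem (hV : IsLampTriple V s V₀ v) {w : LampBase p n} {j : ℤ}
    (h : lampElt w j ∈ V) : (s : ℤ) ∣ j := by
  have : Multiplicative.ofAdd j ∈ V.map SemidirectProduct.rightHom := ⟨_, h, rfl⟩
  rw [hV.map_right] at this
  obtain ⟨k, hk⟩ := this
  have hk : k • (s : ℤ) = j := hk
  exact ⟨k, by rw [← hk, smul_eq_mul, mul_comm]⟩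

theorem sub_mem (hV : IsLampTriple V s V₀ v) {u w : LampBase p n} {j : ℤ}
    (hu : lampElt u j ∈ V) (hw : lampElt w j ∈ V) : w - u ∈ V₀ := by
  rw [hV.mem_base]
  have h : lampElt w j * (lampElt u j)⁻¹ = lampElt (w - u) 0 := by
    rw [mul_inv_eq_iff_eq_mul, lampElt_mul]
    simp
  rw [← h]
  exact V.mul_mem hw (V.inv_mem hu)

theorem add_mem (hV : IsLampTriple V s V₀ v) {u w : LampBase p n} {j : ℤ}
    (hu : u ∈ V₀) (hw : lampElt w j ∈ V) : lampElt (u + w) j ∈ V := by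
  have := V.mul_mem ((hV.mem_base u).1 hu) hw
  rwa [lampElt_mul, T_zero, one_smul, zero_add] at this

theorem T_smul_mem (hV : IsLampTriple V s V₀ v) {u : LampBase p n} (hu : u ∈ V₀) (k : ℤ) :
    (T (s * k) : (ZMod p)[T;T⁻¹]) • u ∈ V₀ := by
  obtain ⟨vk, hk, -⟩ := exists_lampElt_zpow v s k
  have hkV : lampElt vk (s * k) ∈ V := hk ▸ V.zpow_mem hV.elt_mem k
  have := V.mul_mem hkV ((hV.mem_base u).1 hu)
  rw [lampElt_mul, add_zero] at this
  simpa using hV.sub_mem hkV this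

theorem isAdicClosed (hV : IsLampTriple V s V₀ v)
    (h : ∀ w j, InLampClosure V w j → lampElt w j ∈ V) : IsAdicClosed V₀ := by
  intro w hw
  rw [hV.mem_base]
  refine h w 0 fun m => ?_
  obtain ⟨u, hu, z, hz⟩ := hw m
  exact ⟨u, z, 0, (hV.mem_base u).1 hu, by simp, hz⟩

theorem isProPClosed_iff_of_zero [Fact p.Prime] (hV : IsLampTriple V 0 V₀ v) :
    IsProPClosed p V ↔ IsClosedInCompleted V₀ := by
  rw [isProPClosed_iff, isClosedInCompleted_iff]
  refine ⟨hV.isAdicClosed, fun h w j hw => ?_⟩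
  have hj : 0 = j := eq_of_forall_pow_dvd_sub (p := p) fun m => by
    obtain ⟨u, z, i, hu, hi, -⟩ := hw m
    have := hV.dvd_of_mem hu
    rw [Nat.cast_zero, zero_dvd_iff] at this
    rwa [this] at hi
  subst hj
  rw [← hV.mem_base]
  refine h w fun m => ?_
  obtain ⟨u, z, i, hu, -, hz⟩ := hw m
  have := hV.dvd_of_mem hu
  rw [Nat.cast_zero, zero_dvd_iff] at this
  subst this
  exact ⟨u, (hV.mem_base u).2 hu, z, hz⟩

end IsLampTriple

/-! ### Subgroups that are invariant under a power of the shift -/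

theorem map_lampShift_eq_iff {p n e : ℕ} {U : AddSubgroup (LampBase p n)} :
    U.map (lampShift p n e).toAddMonoidHom = U ↔
      ∀ u ∈ U, ∀ k : ℤ, (T (e * k) : (ZMod p)[T;T⁻¹]) • u ∈ U := by
  constructor
  · intro h u hu k
    rw [← laurentExpand_T]
    exact laurentExpand_smul_mem h _ u hu
  · intro h
    ext u
    constructor
    · rintro ⟨w, hw, rfl⟩
      have := h w hw 1
      rwa [mul_one] at this
    · intro hu
      refine ⟨(T (-e : ℤ) : (ZMod p)[T;T⁻¹]) • u, ?_, (lampShift p n e).right_inv u⟩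
      simpa using h u hu (-1)

/-- The quotient `(x^(ek) - 1)/(x^e - 1)` is a Laurent polynomial in `x^e`, hence preserves `U`. -/
theorem exists_T_sub_one_smul_eq {p n e : ℕ} {U : AddSubgroup (LampBase p n)}
    (hU : ∀ u ∈ U, ∀ k : ℤ, (T (e * k) : (ZMod p)[T;T⁻¹]) • u ∈ U) {u : LampBase p n} (hu : u ∈ U)
    (k : ℤ) : ∃ u' ∈ U,
      (T (e * k) - 1 : (ZMod p)[T;T⁻¹]) • u = (T (e : ℤ) - 1 : (ZMod p)[T;T⁻¹]) • u' := by
  obtain ⟨c, hc⟩ := T_sub_one_dvd_T_mul_sub_one (F := ZMod p) 1 k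
  refine ⟨laurentExpand p e c • u, laurentExpand_smul_mem (map_lampShift_eq_iff.2 hU) _ u hu, ?_⟩
  have := congrArg (laurentExpand p e) hc
  rw [map_mul, map_sub, map_sub, map_one, laurentExpand_T, laurentExpand_T, one_mul, mul_one]
    at this
  rw [this, mul_smul]

theorem lampPeriod_dvd_iff {p n e : ℕ} {U : AddSubgroup (LampBase p n)} (he : 0 < e) :
    lampPeriod U ∣ e ↔ ∀ u ∈ U, ∀ k : ℤ, (T (e * k) : (ZMod p)[T;T⁻¹]) • u ∈ U := by
  constructor
  · rintro ⟨c, rfl⟩ u hu k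
    have h := map_lampShift_eq_iff.1 (lampPeriod_spec (Nat.pos_of_mul_pos_right he)) u hu (c * k)
    rwa [← mul_assoc, ← Nat.cast_mul] at h
  · intro h
    have hmem : e ∈ {e : ℕ | 0 < e ∧ U.map (lampShift p n e).toAddMonoidHom = U} :=
      ⟨he, map_lampShift_eq_iff.2 h⟩
    -- The set of periods is nonempty, so the infimum is a genuine period and not the default `0`. A
    -- nonzero remainder of `e` would be a smaller one.
    have hpos : 0 < lampPeriod U := (Nat.sInf_mem ⟨e, hmem⟩).1
    have hinv := map_lampShift_eq_iff.1 (lampPeriod_spec hpos)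
    by_contra hdvd
    have hr : 0 < e % lampPeriod U := Nat.pos_of_ne_zero fun h0 => hdvd (Nat.dvd_of_mod_eq_zero h0)
    refine (Nat.mod_lt e hpos).not_ge (Nat.sInf_le ⟨hr, map_lampShift_eq_iff.2 fun u hu k => ?_⟩)
    have h1 : ((e % lampPeriod U : ℕ) : ℤ) * k =
        e * k + lampPeriod U * (-(e / lampPeriod U : ℕ) * k) := by
      have : (e : ℤ) = (e % lampPeriod U : ℕ) + lampPeriod U * (e / lampPeriod U : ℕ) := by
        exact_mod_cast (Nat.mod_add_div _ _).symm
      linear_combination (-k) * this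
    rw [h1, T_add, mul_smul]
    exact h _ (hinv _ hu _) _

/-! ### Congruences modulo `(x - 1)^(p^m)` -/

/-- Write `s = p^a s'` with `s'` prime to `p`; then `s'` is invertible modulo `p^m`. -/
theorem exists_pow_dvd_mul_sub {p s : ℕ} [hp : Fact p.Prime] (hs : 0 < s) (m : ℕ) {q : ℤ}
    (hq : ((p ^ padicValNat p s : ℕ) : ℤ) ∣ q) : ∃ k : ℤ, ((p ^ m : ℕ) : ℤ) ∣ s * k - q := by
  obtain ⟨c, rfl⟩ := hq
  obtain ⟨s', hs'⟩ := pow_padicValNat_dvd (p := p) (n := s)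
  have hcop : Nat.Coprime s' (p ^ m) := by
    refine Nat.Coprime.pow_right m (((Nat.Prime.coprime_iff_not_dvd hp.out).2 fun h => ?_).symm)
    refine pow_succ_padicValNat_not_dvd (p := p) hs.ne' ?_
    rw [pow_succ]
    nth_rewrite 2 [hs']
    exact mul_dvd_mul_left _ h
  obtain ⟨a, b, hab⟩ := Nat.isCoprime_iff_coprime.2 hcop
  refine ⟨a * c, -(b * c * (p ^ padicValNat p s : ℕ)), ?_⟩
  nth_rewrite 1 [hs']
  push_cast at hab ⊢
  linear_combination (p ^ padicValNat p s * c : ℤ) * hab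

theorem T_sub_T_smul {p n m : ℕ} [Fact p.Prime] {i j : ℤ} (h : ((p ^ m : ℕ) : ℤ) ∣ i - j)
    (w : LampBase p n) : ∃ z : LampBase p n, (T i : (ZMod p)[T;T⁻¹]) • w =
      (T j : (ZMod p)[T;T⁻¹]) • w + (T 1 - 1 : (ZMod p)[T;T⁻¹]) ^ p ^ m • z := by
  obtain ⟨c, hc⟩ := T_sub_one_dvd_T_sub_T (F := ZMod p) h
  refine ⟨c • w, ?_⟩
  rw [smul_smul, ← T_pow_char_sub_one, ← hc, sub_smul, add_sub_cancel]

theorem T_one_sub_one_pow_smul_injective (p n m : ℕ) [Fact p.Prime] :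
    Function.Injective fun w : LampBase p n => (T 1 - 1 : (ZMod p)[T;T⁻¹]) ^ m • w :=
  smul_right_injective _ (pow_ne_zero _ (T_one_sub_one_ne_zero p))

/-- Cancelling `(x - 1)^(p^a)` at level `m + a + 1` still leaves precision `p^m`. -/
theorem pow_le_pow_sub_pow (p a m : ℕ) [hp : Fact p.Prime] : p ^ m ≤ p ^ (m + a + 1) - p ^ a := by
  have h1 : p ^ m ≤ p ^ (m + a) := Nat.pow_le_pow_right hp.out.pos (by omega)
  have h2 : p ^ a ≤ p ^ (m + a) := Nat.pow_le_pow_right hp.out.pos (by omega)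
  have h3 : p ^ (m + a) * 2 ≤ p ^ (m + a + 1) := by
    rw [pow_succ]
    exact Nat.mul_le_mul_left _ hp.out.two_le
  omega

theorem pow_smul_eq_pow_smul_pow_sub {p n a b : ℕ} (h : a ≤ b) (z : LampBase p n) :
    (T 1 - 1 : (ZMod p)[T;T⁻¹]) ^ b • z =
      (T 1 - 1 : (ZMod p)[T;T⁻¹]) ^ a • (T 1 - 1 : (ZMod p)[T;T⁻¹]) ^ (b - a) • z := by
  rw [smul_smul, ← pow_add, Nat.add_sub_cancel' h]

/-- Division by `x^s - 1` costs only `p^a` in precision. Choose `t` with `st ≡ p^a` modulo `p^m` and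
multiply by `(x^(st) - 1)/(x^s - 1)`: this turns `x^s - 1` into `(x - 1)^(p^a)` up to a multiple of
`(x - 1)^(p^m)`, and `𝓐_n` is torsion-free. -/
theorem exists_eq_of_T_sub_one_smul_eq {p n s m : ℕ} [hp : Fact p.Prime] (hs : 0 < s)
    (hm : padicValNat p s ≤ m) {y z : LampBase p n}
    (h : (T (s : ℤ) - 1 : (ZMod p)[T;T⁻¹]) • z = (T 1 - 1 : (ZMod p)[T;T⁻¹]) ^ p ^ m • y) :
    ∃ y' : LampBase p n,
      z = (T 1 - 1 : (ZMod p)[T;T⁻¹]) ^ (p ^ m - p ^ padicValNat p s) • y' := by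
  obtain ⟨t, ht⟩ := exists_pow_dvd_mul_sub (p := p) hs m (dvd_refl _)
  obtain ⟨c, hc⟩ := T_sub_one_dvd_T_mul_sub_one (F := ZMod p) (s : ℤ) t
  obtain ⟨d, hd⟩ := T_sub_T_smul ht z
  refine ⟨c • y - d, T_one_sub_one_pow_smul_injective p n (p ^ padicValNat p s) ?_⟩
  dsimp only
  rw [← pow_smul_eq_pow_smul_pow_sub (Nat.pow_le_pow_right hp.out.pos hm), smul_sub,
    smul_comm _ c y, ← h, smul_smul, mul_comm, ← hc, sub_smul, hd, ← T_pow_char_sub_one]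
  module

namespace IsLampTriple

variable {p n s : ℕ} {V : Subgroup (Lamplighter p n)} {V₀ : AddSubgroup (LampBase p n)}
  {v : LampBase p n}

theorem lampPeriod_dvd [hp : Fact p.Prime] (hV : IsLampTriple V s V₀ v) (hs : 0 < s)
    (hcl : IsAdicClosed V₀) : lampPeriod V₀ ∣ p ^ padicValNat p s := by
  refine (lampPeriod_dvd_iff (pow_pos hp.out.pos _)).2 fun u hu k => hcl _ fun m => ?_
  obtain ⟨t, ht⟩ := exists_pow_dvd_mul_sub (p := p) hs m (Dvd.intro k rfl)
  rw [dvd_sub_comm] at ht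
  obtain ⟨z, hz⟩ := T_sub_T_smul ht u
  exact ⟨_, hV.T_smul_mem hu t, z, hz⟩

/-- A solution `w` of the relation would put `(w, q)` in the closure of `V`, although `s` does not
divide `q`. -/
theorem not_exists_of_closed [hp : Fact p.Prime] (hV : IsLampTriple V s V₀ v)
    (h : ∀ w j, InLampClosure V w j → lampElt w j ∈ V) {q : ℕ} (hq : 0 < q) (hqs : q < s)
    (hqp : padicValNat p s ≤ padicValNat p q) :
    ¬ ∃ w : LampBase p n, ∃ u ∈ V₀, (T q - 1 : (ZMod p)[T;T⁻¹]) • v =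
      (T s - 1 : (ZMod p)[T;T⁻¹]) • w +
        ((T 1 - 1 : (ZMod p)[T;T⁻¹]) ^ p ^ padicValNat p s) • u := by
  rintro ⟨w, u, hu, hwu⟩
  suffices InLampClosure V w q by
    exact Nat.not_dvd_of_pos_of_lt hq hqs (Int.natCast_dvd_natCast.1 (hV.dvd_of_mem (h w q this)))
  intro m
  set a := padicValNat p s with ha
  have hs : 0 < s := hq.trans hqs
  have hpq : ((p ^ a : ℕ) : ℤ) ∣ q :=
    Int.natCast_dvd_natCast.2 ((padicValNat_dvd_iff_le hq.ne').2 hqp)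
  obtain ⟨k, hk⟩ := exists_pow_dvd_mul_sub (p := p) hs (m + a + 1) hpq
  obtain ⟨t, ht⟩ := exists_pow_dvd_mul_sub (p := p) hs (m + a + 1) (dvd_refl _)
  obtain ⟨vk, hvk, hvk'⟩ := exists_lampElt_zpow v s k
  have hvkV : lampElt vk (s * k) ∈ V := hvk ▸ V.zpow_mem hV.elt_mem k
  obtain ⟨u', hu', huu'⟩ := exists_T_sub_one_smul_eq (fun u hu k => hV.T_smul_mem hu k) hu t
  obtain ⟨z₁, hz₁⟩ := T_sub_T_smul hk v
  obtain ⟨z₂, hz₂⟩ := T_sub_T_smul ht u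
  -- Replacing `q` by `sk` and `p^a` by `st` in the relation makes every term a multiple of `x^s -
  -- 1`. Dividing by it shows that `w` is close to `vk - u'`.
  obtain ⟨y, hy⟩ := exists_eq_of_T_sub_one_smul_eq (z := w - (vk - u')) (y := z₂ - z₁) hs
    (m := m + a + 1) (by omega) (by
      rw [← T_pow_char_sub_one, sub_smul, one_smul] at hwu
      rw [← ha] at hz₂
      rw [smul_sub, smul_sub, hvk', ← huu', sub_smul (T (s * k)), sub_smul (T (s * t)), hz₁, hz₂]
      rw [sub_smul] at hwu
      linear_combination (norm := module) -hwu)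
  refine ⟨vk - u', (T 1 - 1 : (ZMod p)[T;T⁻¹]) ^ (p ^ (m + a + 1) - p ^ a - p ^ m) • y, s * k,
    ?_, ?_, ?_⟩
  · rw [sub_eq_neg_add]
    exact hV.add_mem (V₀.neg_mem hu') hvkV
  · rw [dvd_sub_comm]
    exact (Int.natCast_dvd_natCast.2 (pow_dvd_pow p (by omega))).trans hk
  · rw [← pow_smul_eq_pow_smul_pow_sub (pow_le_pow_sub_pow p a m), ← hy, add_sub_cancel]

/-- An approximant of `(w, j)` in `V` is `(u + v_l, sl)` with `u ∈ V₀` and `sl ≡ j`. Multiplying by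
`x^s - 1` turns `v_l - v_k` into `(x^(sl) - x^(sk)) v`, which is close to `x^(sk) (x^q - 1) v`. -/
theorem exists_smul_of_inLampClosure [hp : Fact p.Prime] (hV : IsLampTriple V s V₀ v)
    {w vk : LampBase p n} {j k q : ℤ} (hj : j = q + s * k)
    (hvk : (T (s : ℤ) - 1 : (ZMod p)[T;T⁻¹]) • vk = (T (s * k) - 1 : (ZMod p)[T;T⁻¹]) • v)
    (h : InLampClosure V w j) (m : ℕ) :
    ∃ u ∈ V₀, ∃ y : LampBase p n,
      (T (s : ℤ) - 1 : (ZMod p)[T;T⁻¹]) • (w - vk - u) -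
        (T (s * k) : (ZMod p)[T;T⁻¹]) • (T q - 1 : (ZMod p)[T;T⁻¹]) • v =
      (T 1 - 1 : (ZMod p)[T;T⁻¹]) ^ p ^ m • y := by
  obtain ⟨u, z, i, hu, hi, hz⟩ := h m
  obtain ⟨l, rfl⟩ := hV.dvd_of_mem hu
  obtain ⟨vl, hvl, hvl'⟩ := exists_lampElt_zpow v s l
  have hvlV : lampElt vl (s * l) ∈ V := hvl ▸ V.zpow_mem hV.elt_mem l
  obtain ⟨z', hz'⟩ := T_sub_T_smul hi v
  refine ⟨u - vl, hV.sub_mem hvlV hu, (T (s : ℤ) - 1 : (ZMod p)[T;T⁻¹]) • z - z', ?_⟩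
  rw [hj, add_comm, T_add, mul_smul] at hz'
  have h1 : w - vk - (u - vl) = vl - vk + (T 1 - 1 : (ZMod p)[T;T⁻¹]) ^ p ^ m • z := by
    rw [hz]; abel
  rw [h1, smul_add, smul_sub (T (s : ℤ) - 1 : (ZMod p)[T;T⁻¹]) vl vk, hvk, hvl', sub_smul, sub_smul,
    sub_smul (T q), smul_sub (T (s * k)), hz', smul_sub, smul_comm]
  module

theorem closed_of_forall_not_exists [hp : Fact p.Prime] (hV : IsLampTriple V s V₀ v) (hs : 0 < s)
    (hcl : IsAdicClosed V₀) (hper : lampPeriod V₀ ∣ p ^ padicValNat p s)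
    (hqs : ∀ q : ℕ, 0 < q → q < s → padicValNat p s ≤ padicValNat p q →
      ¬ ∃ w : LampBase p n, ∃ u ∈ V₀, (T q - 1 : (ZMod p)[T;T⁻¹]) • v =
        (T s - 1 : (ZMod p)[T;T⁻¹]) • w +
          ((T 1 - 1 : (ZMod p)[T;T⁻¹]) ^ p ^ padicValNat p s) • u)
    {w : LampBase p n} {j : ℤ} (h : InLampClosure V w j) : lampElt w j ∈ V := by
  set a := padicValNat p s with ha
  have hs' : (0 : ℤ) < s := by exact_mod_cast hs
  have hinv := (lampPeriod_dvd_iff (pow_pos hp.out.pos a)).1 hper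
  have hcl' := (isAdicClosed_iff (k := fun m => p ^ (m + a + 1) - p ^ a) fun m =>
    (Nat.lt_pow_self hp.out.one_lt).le.trans (pow_le_pow_sub_pow p a m)).1 hcl
  have hpas : ((p ^ a : ℕ) : ℤ) ∣ s := Int.natCast_dvd_natCast.2 pow_padicValNat_dvd
  obtain ⟨q, hq⟩ := Int.eq_ofNat_of_zero_le (Int.emod_nonneg j hs'.ne')
  have hj : j = q + s * (j / s) := by rw [← hq, Int.emod_add_mul_ediv]
  have hlt : q < s := by
    have := Int.emod_lt_of_pos j hs'
    omega
  set k := j / s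
  obtain ⟨vk, hvk, hvk'⟩ := exists_lampElt_zpow v s k
  have hvkV : lampElt vk (s * k) ∈ V := hvk ▸ V.zpow_mem hV.elt_mem k
  have key := hV.exists_smul_of_inLampClosure hj hvk' h
  rcases Nat.eq_zero_or_pos q with rfl | hq0
  · have hw : w - vk ∈ V₀ := hcl' _ fun m => by
      obtain ⟨u, hu, y, hy⟩ := key (m + a + 1)
      simp only [Nat.cast_zero, T_zero, sub_self, zero_smul, smul_zero, sub_zero] at hy
      obtain ⟨y', hy'⟩ := exists_eq_of_T_sub_one_smul_eq hs (by omega) hy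
      exact ⟨u, hu, y', by rw [← hy', add_sub_cancel]⟩
    have := hV.add_mem hw hvkV
    rw [hj]
    simpa using this
  · exfalso
    have hpq : a ≤ padicValNat p q := by
      rw [← padicValNat_dvd_iff_le hq0.ne', ← Int.natCast_dvd_natCast]
      obtain ⟨u, z, i, hu, hi, -⟩ := h a
      have hi' := hpas.trans (hV.dvd_of_mem hu)
      have := dvd_add hi hi'
      rw [sub_add_cancel, hj] at this
      exact (dvd_add_left (hpas.mul_right k)).1 this
    refine hqs q hq0 hlt hpq ?_
    -- Since `p^a` divides `s` and `V₀` is `x^(p^a)`-invariant, `(x^s - 1) u` can be rewritten as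
    -- `(x - 1)^(p^a) u'`, so this factor comes out of the whole right-hand side.
    have hcong : ∀ m : ℕ, ∃ u ∈ V₀, ∃ y : LampBase p n,
        (T (s : ℤ) - 1 : (ZMod p)[T;T⁻¹]) • (w - vk) -
          (T (s * k) : (ZMod p)[T;T⁻¹]) • (T (q : ℤ) - 1 : (ZMod p)[T;T⁻¹]) • v =
        (T 1 - 1 : (ZMod p)[T;T⁻¹]) ^ p ^ a •
          (u + (T 1 - 1 : (ZMod p)[T;T⁻¹]) ^ (p ^ (m + a + 1) - p ^ a) • y) := fun m => by
      obtain ⟨u, hu, y, hy⟩ := key (m + a + 1)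
      obtain ⟨c, hc⟩ := hpas
      obtain ⟨u', hu', huu'⟩ := exists_T_sub_one_smul_eq hinv hu c
      refine ⟨u', hu', y, ?_⟩
      rw [smul_add, ← pow_smul_eq_pow_smul_pow_sub (Nat.pow_le_pow_right hp.out.pos (by omega)),
        ← hy, ← T_pow_char_sub_one, ← huu', ← hc]
      module
    -- The left-hand side does not depend on `m`. After cancelling `(x - 1)^(p^a)`, the element `x₀`
    -- found at level `0` is approximated by `V₀` at every level, hence lies in `V₀`. Multiplying by
    -- `x^(-sk)` then gives the forbidden relation.
    obtain ⟨u₀, -, y₀, h₀⟩ := hcong 0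
    set x₀ := u₀ + (T 1 - 1 : (ZMod p)[T;T⁻¹]) ^ (p ^ (0 + a + 1) - p ^ a) • y₀
    have hx₀ : x₀ ∈ V₀ := hcl' _ fun m => by
      obtain ⟨u, hu, y, hy⟩ := hcong m
      exact ⟨u, hu, y, T_one_sub_one_pow_smul_injective p n (p ^ a) (h₀.symm.trans hy)⟩
    refine ⟨(T (s * -k) : (ZMod p)[T;T⁻¹]) • (w - vk), (T (s * -k) : (ZMod p)[T;T⁻¹]) • (-x₀),
      hV.T_smul_mem (V₀.neg_mem hx₀) _, ?_⟩
    have hTT : (T (s * -k) : (ZMod p)[T;T⁻¹]) * T (s * k) = 1 := by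
      rw [← T_add, ← mul_add, neg_add_cancel, mul_zero, T_zero]
    rw [smul_comm _ (T (s * -k) : (ZMod p)[T;T⁻¹]), smul_comm _ (T (s * -k) : (ZMod p)[T;T⁻¹]),
      ← smul_add, smul_neg, ← h₀, neg_sub, add_sub_cancel, smul_smul, hTT, one_smul]

end IsLampTriple

/-! ### Modules that are separated in the `(x - 1)`-adic topology -/

/-- `⋂ (x - 1)^m M = 0`. -/
def IsTSeparated (p : ℕ) (M : Type*) [AddCommGroup M] [Module (ZMod p)[T;T⁻¹] M] : Prop :=
  ∀ y : M, (∀ m : ℕ, ∃ z : M, y = (T 1 - 1 : (ZMod p)[T;T⁻¹]) ^ m • z) → y = 0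

theorem IsTSeparated.of_equiv {p : ℕ} {M M' : Type*} [AddCommGroup M] [Module (ZMod p)[T;T⁻¹] M]
    [AddCommGroup M'] [Module (ZMod p)[T;T⁻¹] M'] (φ : M ≃ₗ[(ZMod p)[T;T⁻¹]] M')
    (h : IsTSeparated p M) : IsTSeparated p M' := by
  intro y hy
  rw [← φ.symm.map_eq_zero_iff]
  refine h _ fun m => ?_
  obtain ⟨z, rfl⟩ := hy m
  exact ⟨φ.symm z, map_smul _ _ _⟩

theorem isTSeparated_pi_iff {p : ℕ} {ι : Type*} {M : ι → Type*} [∀ i, AddCommGroup (M i)]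
    [∀ i, Module (ZMod p)[T;T⁻¹] (M i)] :
    IsTSeparated p (∀ i, M i) ↔ ∀ i, IsTSeparated p (M i) := by
  classical
  constructor
  · intro h i y hy
    have : Pi.single i y = (0 : ∀ i, M i) := h _ fun m => by
      obtain ⟨z, rfl⟩ := hy m
      exact ⟨Pi.single i z, Pi.single_smul _ _ _⟩
    simpa using congrFun this i
  · intro h y hy
    funext i
    refine h i _ fun m => ?_
    obtain ⟨z, rfl⟩ := hy m
    exact ⟨z i, rfl⟩

open Polynomial in
theorem eq_one_sub_X_of_dvd {F : Type*} [Field F] {q : F[X]} (hq : Irreducible q)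
    (h0 : q.eval 0 = 1) (h : q ∣ 1 - X) : q = 1 - X := by
  have hX : Irreducible (1 - X : F[X]) := by
    rw [← neg_sub, ← C_1]
    exact (Associated.refl _).neg_right.irreducible (irreducible_X_sub_C (1 : F))
  obtain ⟨u, hu⟩ := (hq.dvd_irreducible_iff_associated hX).1 h
  obtain ⟨c, hc, hcu⟩ := Polynomial.isUnit_iff.1 u.isUnit
  have := congrArg (eval 0) hu
  rw [← hcu, eval_mul, h0, eval_C, one_mul, eval_sub, eval_one, eval_X, sub_zero] at this
  rw [← hu, ← hcu, this, C_1, mul_one]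

open Polynomial in
-- If `q` is coprime to `x - 1`, then `x - 1` is invertible on `R/q^r`, so separatedness would force
-- this module to vanish. If `q = 1 - x`, a power of `x - 1` kills it; if `q = 0` and `r > 0`, it is
-- `R`, which is separated.
theorem isTSeparated_quotient_iff {p : ℕ} [Fact p.Prime] {q : (ZMod p)[X]} {r : ℕ}
    (hq : q = 0 ∨ (Irreducible q ∧ q.eval 0 = 1)) :
    IsTSeparated p ((ZMod p)[T;T⁻¹] ⧸ Ideal.span {toLaurent (q ^ r)}) ↔
      q = 0 ∨ r = 0 ∨ q = 1 - X := by
  have hT : ∀ m : ℕ, (T 1 - 1 : (ZMod p)[T;T⁻¹]) ^ m = toLaurent ((X - 1) ^ m) := fun m => by simp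
  have hsmul : ∀ f g : (ZMod p)[T;T⁻¹], f • Ideal.Quotient.mk (Ideal.span {toLaurent (q ^ r)}) g =
      Ideal.Quotient.mk _ (f * g) := fun _ _ => rfl
  constructor
  · intro h
    by_contra! hcon
    obtain ⟨hq0, hr, hqX⟩ := hcon
    obtain ⟨hirr, he⟩ := hq.resolve_left hq0
    have hcop : IsCoprime q (X - 1) := by
      rw [hirr.coprime_iff_not_dvd, ← dvd_neg, neg_sub]
      exact fun hd => hqX (eq_one_sub_X_of_dvd hirr he hd)
    have h1 : (Ideal.Quotient.mk (Ideal.span {toLaurent (q ^ r)})) 1 = 0 := h _ fun m => by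
      obtain ⟨a, b, hab⟩ := hcop.pow (m := r) (n := m)
      refine ⟨Ideal.Quotient.mk _ (toLaurent b), ?_⟩
      rw [hsmul, Ideal.Quotient.eq, Ideal.mem_span_singleton, hT, ← map_mul, ← map_one toLaurent, ← map_sub]
      exact map_dvd _ ⟨a, by linear_combination -hab⟩
    rw [Ideal.Quotient.eq_zero_iff_mem, Ideal.mem_span_singleton, ← isUnit_iff_dvd_one] at h1
    have := laurent_isUnit_of_toLaurent h1 (by simp [he])
    exact hirr.not_isUnit ((isUnit_pow_iff hr).1 this)
  · intro h y hy
    obtain ⟨f, rfl⟩ := Ideal.Quotient.mk_surjective y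
    rw [Ideal.Quotient.eq_zero_iff_mem, Ideal.mem_span_singleton]
    have hy' : ∀ m : ℕ, ∃ g : (ZMod p)[T;T⁻¹],
        toLaurent (q ^ r) ∣ f - (T 1 - 1 : (ZMod p)[T;T⁻¹]) ^ m * g := fun m => by
      obtain ⟨z, hz⟩ := hy m
      obtain ⟨g, rfl⟩ := Ideal.Quotient.mk_surjective z
      refine ⟨g, ?_⟩
      rwa [hsmul, Ideal.Quotient.eq, Ideal.mem_span_singleton] at hz
    -- The case `r = 0` goes first, since `0 ^ 0 = 1` gives the zero module even for `q = 0`.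
    rcases Nat.eq_zero_or_pos r with rfl | hr
    · simp
    rcases h with rfl | rfl | rfl
    · have : f = 0 := eq_zero_of_forall_T_one_sub_one_pow_dvd fun m => by
        obtain ⟨g, hg⟩ := hy' m
        rw [zero_pow hr.ne', map_zero, zero_dvd_iff, sub_eq_zero] at hg
        exact ⟨g, hg⟩
      simp [this]
    · simp
    · obtain ⟨g, hg⟩ := hy' r
      refine (dvd_sub_left ?_).1 hg
      refine Dvd.dvd.mul_right ?_ g
      rw [hT]
      refine map_dvd _ (pow_dvd_pow_of_dvd ?_ r)
      rw [← neg_sub]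
      exact neg_dvd.2 dvd_rfl

open Polynomial in
theorem exists_prod_eq_pow_iff {F ι : Type*} [Field F] [Fintype ι] [DecidableEq F[X]]
    {q : ι → F[X]} {r : ι → ℕ}
    (hq : ∀ i, q i = 0 ∨ (Irreducible (q i) ∧ (q i).eval 0 = 1)) :
    (∃ k : ℕ, ∏ i with q i ≠ 0, q i ^ r i = (1 - X) ^ k) ↔
      ∀ i, q i = 0 ∨ r i = 0 ∨ q i = 1 - X := by
  constructor
  · rintro ⟨k, hk⟩ i
    by_contra! hcon
    obtain ⟨h0, hr, hX⟩ := hcon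
    obtain ⟨hirr, he⟩ := (hq i).resolve_left h0
    refine hX (eq_one_sub_X_of_dvd hirr he (hirr.prime.dvd_of_dvd_pow (n := k) ?_))
    rw [← hk]
    exact (dvd_pow_self _ hr).trans (Finset.dvd_prod_of_mem _ (by simpa using h0))
  · intro h
    refine ⟨∑ i with q i ≠ 0, r i, ?_⟩
    rw [← Finset.prod_pow_eq_pow_sum]
    refine Finset.prod_congr rfl fun i hi => ?_
    rcases (h i).resolve_left (Finset.mem_filter.1 hi).2 with h | h
    · rw [h, pow_zero, pow_zero]
    · rw [h]

/-- On the twisted module `(x - 1)^m` acts as `(x - 1)^(p^b m)`, and these exponents are cofinal.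
This is where the period must be a power of `p`. -/
theorem isAdicClosed_iff_isTSeparated {p n b : ℕ} [hp : Fact p.Prime]
    {U : AddSubgroup (LampBase p n)}
    {W : Submodule (ZMod p)[T;T⁻¹] (TwistedBase p n (p ^ b))}
    (hW : (W : Set (TwistedBase p n (p ^ b))) = (U : Set (LampBase p n))) :
    IsAdicClosed U ↔ IsTSeparated p (TwistedBase p n (p ^ b) ⧸ W) := by
  have hmem : ∀ w : TwistedBase p n (p ^ b), w ∈ W ↔ (show LampBase p n from w) ∈ U :=
    fun w => Set.ext_iff.1 hW w
  have hsmul : ∀ (m : ℕ) (w : TwistedBase p n (p ^ b)), (T 1 - 1 : (ZMod p)[T;T⁻¹]) ^ m • w =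
      (show TwistedBase p n (p ^ b) from (T 1 - 1 : (ZMod p)[T;T⁻¹]) ^ (p ^ b * m) •
        (show LampBase p n from w)) := fun m w => by
    rw [twisted_smul_def, laurentExpand_T_one_sub_one_pow]
  rw [isAdicClosed_iff (k := fun m => p ^ b * m)
    fun m => Nat.le_mul_of_pos_left m (pow_pos hp.out.pos b)]
  constructor
  · intro h y hy
    obtain ⟨w, rfl⟩ := W.mkQ_surjective y
    rw [Submodule.mkQ_apply, Submodule.Quotient.mk_eq_zero, hmem]
    refine h w fun m => ?_
    obtain ⟨z, hz⟩ := hy m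
    obtain ⟨z, rfl⟩ := W.mkQ_surjective z
    rw [← map_smul, Submodule.mkQ_apply, Submodule.mkQ_apply, Submodule.Quotient.eq, hmem,
      hsmul] at hz
    exact ⟨_, hz, z, (sub_add_cancel (G := LampBase p n) _ _).symm⟩
  · intro h w hw
    refine (hmem w).1 ((Submodule.Quotient.mk_eq_zero W).1 (h _ fun m => ?_))
    obtain ⟨u, hu, z, hz⟩ := hw m
    refine ⟨W.mkQ z, (Submodule.Quotient.eq W (x := w)
      (y := (T 1 - 1 : (ZMod p)[T;T⁻¹]) ^ m • (show TwistedBase p n (p ^ b) from z))).2 ?_⟩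
    rw [hsmul, hmem]
    convert hu
    rw [hz]
    exact add_sub_cancel_right (G := LampBase p n) _ _

theorem isAdicClosed_iff_detStar {p n b : ℕ} [hp : Fact p.Prime] {U : AddSubgroup (LampBase p n)}
    (hb : lampPeriod U = p ^ b) :
    IsAdicClosed U ↔ ∃ k : ℕ, detStar U = (1 - Polynomial.X) ^ k := by
  classical
  -- Any decomposition realizing the chosen value of `detStar U` suffices; uniqueness is not needed.
  obtain ⟨-, W, hW, N, q, r, hq, ⟨φ⟩, hf⟩ :=
    isDetStar_detStar (U := U) (hb ▸ pow_pos hp.out.pos b)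
  rw [hf]
  clear hf
  -- The type of `W` depends on `lampPeriod U`, so `W` is generalized before the period is rewritten
  -- as `p ^ b`.
  revert W
  rw [hb]
  intro W hW φ
  rw [isAdicClosed_iff_isTSeparated hW]
  have h : IsTSeparated p (TwistedBase p n (p ^ b) ⧸ W) ↔ IsTSeparated p _ :=
    ⟨IsTSeparated.of_equiv φ, IsTSeparated.of_equiv φ.symm⟩
  rw [h, isTSeparated_pi_iff, forall_congr' fun i => isTSeparated_quotient_iff (hq i),
    ← exists_prod_eq_pow_iff hq]

theorem mainTheorem8 (p : ℕ) [Fact p.Prime] (n : ℕ) (V : Subgroup (Lamplighter p n)) (s : ℕ)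
    (V₀ : AddSubgroup (LampBase p n)) (v : LampBase p n) (hV : IsLampTriple V s V₀ v) :
    IsProPClosed p V ↔
      (s = 0 ∧ IsClosedInCompleted V₀) ∨
      (0 < s ∧
        lampPeriod V₀ ∣ p ^ padicValNat p s ∧
        (∃ k : ℕ, detStar V₀ = (1 - Polynomial.X) ^ k) ∧
        ∀ q : ℕ, 0 < q → q < s → padicValNat p s ≤ padicValNat p q →
          ¬ ∃ w : LampBase p n, ∃ u ∈ V₀,
            (T q - 1 : (ZMod p)[T;T⁻¹]) • v =
              (T s - 1 : (ZMod p)[T;T⁻¹]) • w +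
                ((T 1 - 1 : (ZMod p)[T;T⁻¹]) ^ p ^ padicValNat p s) • u) := by
  rcases Nat.eq_zero_or_pos s with rfl | hs
  · simp [hV.isProPClosed_iff_of_zero]
  · simp only [hs.ne', hs, false_and, false_or, true_and]
    rw [isProPClosed_iff]
    constructor
    · intro h
      have hcl := hV.isAdicClosed h
      have hper := hV.lampPeriod_dvd hs hcl
      obtain ⟨b, -, hb⟩ := (Nat.dvd_prime_pow Fact.out).1 hper
      exact ⟨hper, (isAdicClosed_iff_detStar hb).1 hcl,
        fun q hq hqs hqp => hV.not_exists_of_closed h hq hqs hqp⟩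
    · rintro ⟨hper, hdet, hq⟩ w j hw
      obtain ⟨b, -, hb⟩ := (Nat.dvd_prime_pow Fact.out).1 hper
      exact hV.closed_of_forall_not_exists hs ((isAdicClosed_iff_detStar hb).2 hdet) hper hq hw

end
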